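/- For a prime $p$ and $q=p^m$ ($m\ge 1$), let $\mathbb F_q$ be the field with $q$ elements, $\mathrm{Tr}(x)=\sum_{i=0}^{m-1}x^{p^i}$ its absolute trace, $\psi(x)=\exp(2\pi i\,\mathrm{Tr}(x)/p)$, and for $a\in\mathbb F_q$ let $$S_n(a)=\sum_{x\in\mathbb F_q}\psi(ax^n).$$ There is a function $o(1)$ of $q$ alone, tending to $0$ as $q\to\infty$, with the following property. For all constants $\kappa,k,c>0$ there is a constant $C>0$, depending only on $\kappa,k,c$, such that for every prime power $q=p^m$ and every positive integer $n\mid q-1$ satisfying $$\gcd\Big(n,\frac{q-1}{p^\nu-1}\Big)\le \kappa\,\frac{n}{p^{\nu/2}}\qquad\text{for all }\nu\text{ with }1\le\nu<m,\ \nu\mid m,$$ and for every $\varepsilon>0$, $$\max_{a\in\mathbb F_q^*}|S_n(a)|\le C\cdot\begin{cases} q^{1/2}n, & \text{if } n\lesssim q^{1/2-1/130},\\ q^{92/128+o(1)}n^{71/128}, & \text{if } q^{1/2-1/130}\lesssim n\ll q^{1/2},\\ q^{91/128+o(1)}n^{73/128}, & \text{if } q^{1/2}\ll n\lesssim q^{1/2+1/2642},\\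 q^{229/264}n^{17/66}, & \text{if } q^{1/2+1/2642}\lesssim n\ll q^{1/2+1/68-\varepsilon}.\end{cases}$$ Here, in the conditions on $n$, $X\ll Y$ means $X\le kY$ and $X\lesssim Y$ means $X\le k(\log Y)^cY$. (The four ranges may overlap; each bound holds throughout its range.) -/

import Mathlib

open Filter Topology

/-- The additive character `ψ(x) = exp(2πi Tr(x) / p)` of a finite field `F` of characteristic `p`,
where `Tr : F → ZMod p` is the absolute trace. -/
noncomputable def psi (p : ℕ) [Fact p.Prime] {F : Type*} [Field F] [Algebra (ZMod p) F]
    (x : F) : ℂ :=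
  ZMod.stdAddChar (Algebra.trace (ZMod p) F x)

/-- The Gauss sum `S_n(a) = ∑_{x ∈ F} ψ(a x ^ n)`. -/
noncomputable def powerGaussSum (p : ℕ) [Fact p.Prime] {F : Type*} [Field F] [Fintype F]
    [Algebra (ZMod p) F] (n : ℕ) (a : F) : ℂ :=
  ∑ x : F, psi p (a * x ^ n)

/-- With `q = p ^ m`: `gcd(n, (q - 1) / (p ^ ν - 1)) ≤ κ n / p ^ (ν / 2)` for every divisor `ν` of
`m` with `1 ≤ ν < m`. (For such `ν` the natural number `p ^ ν - 1` is positive and divides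
`q - 1`.) -/
def SubfieldGcdBound (κ : ℝ) (p m n : ℕ) : Prop :=
  ∀ ν : ℕ, 1 ≤ ν → ν < m → ν ∣ m →
    (Nat.gcd n ((p ^ m - 1) / (p ^ ν - 1)) : ℝ) ≤ κ * ((n : ℝ) / (p : ℝ) ^ ((ν : ℝ) / 2))

/-- `X ≲ Y` with explicit constants: `X ≤ k (log Y) ^ c Y`. -/
def LeUpToLog (k c X Y : ℝ) : Prop :=
  X ≤ k * Real.log Y ^ c * Y

/-! Let `G` be the group of `n`-th powers, of order `N = (q - 1) / n`, let `μ` be the modulus of the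
mean of the character over `G`, and let `w = charMeanSq`, which is `G`-invariant and positive
definite. Since `S_n(a)` is `1` plus `q - 1` times that mean, `μ` has to be bounded. In the first
range Parseval (`card_mul_norm_charMean_sq_le`) suffices.

For the other ranges the core is `N ^ 3 * μ ^ 56 ≤ 2 ^ 14 * q`. Cauchy-Schwarz and averaging produce
shifts `b₁, b₂` for which `w(1+g+h) w(b₁+gh) w(b₂+gh)` is large on average over `g, h ∈ G`, with `b₂
/ b₁` in no proper subfield. On a suitable `Q ⊆ G` every normalised degree is then at least `c = μ ^
14 / 8`. These degrees are the values at `(1, g)` of a positive definite function on `F × F`, namely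
`pairMean`, so many differences of points `(x, gx)` are again popular.

If `N ^ 3 * c ^ 4 > 4 * q`, the set `R` of slopes of popular points is stable under `r ↦ -(1 + r)`
and `r ↦ -bᵢ / r`, one map for each factor of the weight, apart from the value `r = -1`. The last
two compose to multiplication by `b₂ / b₁`, a ring generator of `F`, so every nonzero slope is
popular (`eq_univ_of_stable`). That makes the total mass of `pairMean` exceed its Parseval bound
(`card_pow_three_mul_le`).

The result is `|S_n(a)| ≪ q ^ (54/56) * n ^ (3/56)`, unless subfield elements fill too much of `G`;
the gcd hypothesis then gives `|S_n(a)| ≪ q ^ 0.985`. Near `n = q ^ (1/2)` both beat the three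
remaining bounds by a power of `q`, which absorbs the logarithms. -/

/-! ### Nonnegative mixtures of additive characters -/

/-- A function on an additive group that is a finite combination of additive characters with
nonnegative coefficients. -/
def IsCharMixture {V : Type*} [AddCommGroup V] (f : V → ℂ) : Prop :=
  ∃ (ι : Type) (_ : Fintype ι) (c : ι → ℝ) (χ : ι → AddChar V ℂ),
    (∀ i, 0 ≤ c i) ∧ ∀ p, f p = ∑ i, (c i : ℂ) * χ i p

namespace IsCharMixture

variable {V : Type*} [AddCommGroup V]

lemma mul {f g : V → ℂ} (hf : IsCharMixture f) (hg : IsCharMixture g) :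
    IsCharMixture (fun p => f p * g p) := by
  obtain ⟨ι, _, c, χ, hc, hf⟩ := hf
  obtain ⟨κ, _, d, η, hd, hg⟩ := hg
  refine ⟨ι × κ, inferInstance, fun i => c i.1 * d i.2, fun i => χ i.1 * η i.2,
    fun i => mul_nonneg (hc _) (hd _), fun p => ?_⟩
  simp only [hf, hg]
  rw [Finset.sum_mul_sum, Fintype.sum_prod_type]
  refine Finset.sum_congr rfl fun i _ => Finset.sum_congr rfl fun j _ => ?_
  simp only [AddChar.mul_apply]
  push_cast
  ring

lemma zero : IsCharMixture (fun _ : V => (0 : ℂ)) :=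
  ⟨Empty, inferInstance, fun _ => 0, fun _ => 1, fun _ => le_rfl, fun _ => by simp⟩

lemma add {f g : V → ℂ} (hf : IsCharMixture f) (hg : IsCharMixture g) :
    IsCharMixture (fun p => f p + g p) := by
  obtain ⟨ι, _, c, χ, hc, hf⟩ := hf
  obtain ⟨κ, _, d, η, hd, hg⟩ := hg
  refine ⟨ι ⊕ κ, inferInstance, Sum.elim c d, Sum.elim χ η, ?_, fun p => ?_⟩
  · rintro (i | i)
    · exact hc i
    · exact hd i
  · simp only [hf, hg, Fintype.sum_sum_type, Sum.elim_inl, Sum.elim_inr]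

lemma sum {α : Type*} (s : Finset α) {f : α → V → ℂ} (hf : ∀ a ∈ s, IsCharMixture (f a)) :
    IsCharMixture (fun p => ∑ a ∈ s, f a p) := by
  classical
  induction s using Finset.induction_on with
  | empty => simpa using zero
  | insert a s ha ih =>
    simp only [Finset.sum_insert ha]
    exact (hf a (Finset.mem_insert_self a s)).add
      (ih fun b hb => hf b (Finset.mem_insert_of_mem hb))

lemma div_real {f : V → ℂ} (hf : IsCharMixture f) {t : ℝ} (ht : 0 ≤ t) :
    IsCharMixture (fun p => f p / (t : ℂ)) := by
  obtain ⟨ι, _, c, χ, hc, hf⟩ := hf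
  refine ⟨ι, inferInstance, fun i => c i / t, χ, fun i => div_nonneg (hc i) ht, fun p => ?_⟩
  simp only [hf, Finset.sum_div]
  refine Finset.sum_congr rfl fun i _ => ?_
  push_cast
  ring

lemma comp {W : Type*} [AddCommGroup W] {f : V → ℂ} (hf : IsCharMixture f) (L : W →+ V) :
    IsCharMixture (fun p => f (L p)) := by
  obtain ⟨ι, _, c, χ, hc, hf⟩ := hf
  exact ⟨ι, inferInstance, c, fun i => (χ i).compAddMonoidHom L, hc, fun p => by simp [hf]⟩

/-- The large sieve type inequality for positive definite functions. -/
lemma sq_sum_le [Finite V] {f : V → ℝ} (hf : IsCharMixture (fun p => (f p : ℂ)))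
    (S : Finset V) :
    (∑ p ∈ S, f p) ^ 2 ≤ f 0 * ∑ p ∈ S, ∑ p' ∈ S, f (p - p') := by
  obtain ⟨ι, _, c, χ, hc, hf⟩ := hf
  set X : ι → ℂ := fun i => ∑ p ∈ S, χ i p with hX
  have h0 : f 0 = ∑ i, c i := by
    have := hf 0
    simp only [AddChar.map_zero_eq_one, mul_one] at this
    exact_mod_cast this
  have h1 : ((∑ p ∈ S, f p : ℝ) : ℂ) = ∑ i, (c i : ℂ) * X i := by
    push_cast
    simp only [hf, hX, Finset.mul_sum]
    exact Finset.sum_comm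
  have h2 : ∑ p ∈ S, ∑ p' ∈ S, f (p - p') = ∑ i, c i * ‖X i‖ ^ 2 := by
    have : ((∑ p ∈ S, ∑ p' ∈ S, f (p - p') : ℝ) : ℂ) = ((∑ i, c i * ‖X i‖ ^ 2 : ℝ) : ℂ) := by
      push_cast
      simp only [hf, ← Complex.mul_conj', hX, map_sum, Finset.sum_mul_sum]
      simp only [Finset.mul_sum]
      rw [Finset.sum_congr rfl fun p _ => Finset.sum_comm, Finset.sum_comm]
      refine Finset.sum_congr rfl fun i _ => Finset.sum_congr rfl fun p _ =>
        Finset.sum_congr rfl fun p' _ => ?_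
      rw [sub_eq_add_neg, AddChar.map_add_eq_mul, AddChar.map_neg_eq_conj]
    exact_mod_cast this
  have h3 : |∑ p ∈ S, f p| ≤ ∑ i, c i * ‖X i‖ := by
    calc |∑ p ∈ S, f p| = ‖((∑ p ∈ S, f p : ℝ) : ℂ)‖ := by rw [Complex.norm_real, Real.norm_eq_abs]
      _ ≤ ∑ i, ‖(c i : ℂ) * X i‖ := by rw [h1]; exact norm_sum_le _ _
      _ = ∑ i, c i * ‖X i‖ := by
        refine Finset.sum_congr rfl fun i _ => ?_
        rw [norm_mul, Complex.norm_real, Real.norm_of_nonneg (hc i)]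
  -- Cauchy-Schwarz for the weights `c i`, whose total mass is `f 0`.
  rw [h0, h2, ← sq_abs]
  calc |∑ p ∈ S, f p| ^ 2 ≤ (∑ i, c i * ‖X i‖) ^ 2 := by gcongr
    _ ≤ _ := Finset.sum_sq_le_sum_mul_sum_of_sq_le_mul _ (fun i _ => hc i)
        (fun i _ => mul_nonneg (hc i) (sq_nonneg _)) (fun i _ => le_of_eq (by ring))

/-- If a positive definite function is at least `c` on `S` and less than `c ^ 2 / 2` on the
differences of distinct elements, then `S` is small. -/
lemma card_le [Finite V] {f : V → ℝ} (hf : IsCharMixture (fun p => (f p : ℂ)))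
    (hf0 : ∀ p, f p ≤ 1) (hpos : 0 ≤ f 0) {c : ℝ} (hc : 0 < c) (S : Finset V)
    (hS : ∀ p ∈ S, c ≤ f p) (hd : ∀ p ∈ S, ∀ p' ∈ S, p ≠ p' → f (p - p') ≤ c ^ 2 / 2) :
    (S.card : ℝ) ≤ 2 / c ^ 2 := by
  classical
  have h1 := hf.sq_sum_le S
  have h2 : S.card * c ≤ ∑ p ∈ S, f p := by
    simpa using Finset.card_nsmul_le_sum S f c hS
  have h3 : ∑ p ∈ S, ∑ p' ∈ S, f (p - p') ≤ S.card * (1 + S.card * (c ^ 2 / 2)) := by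
    rw [← nsmul_eq_mul]
    refine Finset.sum_le_card_nsmul _ _ _ fun p hp => ?_
    calc ∑ p' ∈ S, f (p - p') ≤ ∑ p' ∈ S, ((if p = p' then 1 else 0) + c ^ 2 / 2) := by
          refine Finset.sum_le_sum fun p' hp' => ?_
          split_ifs with h
          · linarith [hf0 (p - p'), sq_nonneg c]
          · linarith [hd p hp p' hp' h]
      _ = _ := by simp [Finset.sum_add_distrib, hp]
  have h4 : (S.card * c) ^ 2 ≤ S.card * (1 + S.card * (c ^ 2 / 2)) := by
    calc (S.card * c) ^ 2 ≤ (∑ p ∈ S, f p) ^ 2 := by gcongr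
      _ ≤ f 0 * (S.card * (1 + S.card * (c ^ 2 / 2))) := h1.trans (by gcongr)
      _ ≤ 1 * _ := by gcongr; exact hf0 0
      _ = _ := one_mul _
  rcases Nat.eq_zero_or_pos S.card with h | h
  · rw [h, Nat.cast_zero]; positivity
  · have hk : (0 : ℝ) < S.card := by exact_mod_cast h
    rw [le_div_iff₀ (by positivity)]
    have : (S.card : ℝ) * (S.card * c ^ 2) ≤ S.card * 2 := by nlinarith
    exact le_of_mul_le_mul_left this hk

end IsCharMixture

/-! ### Subsets of large minimal degree -/

/-- A set maximising (total weight) - `D` * (size) cannot be improved by deleting a vertex, so each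
vertex carries weight at least `D / 2`. -/
lemma exists_minDegree {ι : Type*} [Fintype ι] [DecidableEq ι] (A : ι → ι → ℝ)
    (hsymm : ∀ i j, A i j = A j i) (hA : ∀ i j, 0 ≤ A i j) {D : ℝ}
    (h : D * Fintype.card ι < ∑ i, ∑ j, A i j) :
    ∃ Q : Finset ι, Q.Nonempty ∧ ∀ i ∈ Q, D / 2 ≤ ∑ j ∈ Q, A i j := by
  obtain ⟨Q, -, hQ⟩ := Finset.exists_max_image (Finset.univ : Finset (Finset ι))
    (fun Q => (∑ i ∈ Q, ∑ j ∈ Q, A i j) - D * Q.card) ⟨∅, Finset.mem_univ _⟩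
  have hpos : 0 < (∑ i ∈ Q, ∑ j ∈ Q, A i j) - D * Q.card := by
    have := hQ Finset.univ (Finset.mem_univ _)
    rw [Finset.card_univ] at this
    linarith
  refine ⟨Q, ?_, fun i hi => ?_⟩
  · rw [Finset.nonempty_iff_ne_empty]
    rintro rfl
    simp at hpos
  · have h1 := hQ (Q.erase i) (Finset.mem_univ _)
    have h2 : ∑ j ∈ Q, ∑ k ∈ Q, A j k =
        A i i + 2 * ∑ k ∈ Q.erase i, A i k + ∑ j ∈ Q.erase i, ∑ k ∈ Q.erase i, A j k := by
      rw [← Finset.add_sum_erase Q _ hi, ← Finset.add_sum_erase Q (fun k => A i k) hi,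
        Finset.sum_congr rfl fun j (_ : j ∈ Q.erase i) =>
          (Finset.add_sum_erase Q (fun k => A j k) hi).symm, Finset.sum_add_distrib,
        Finset.sum_congr rfl fun j _ => hsymm j i]
      ring
    have h3 : ((Q.erase i).card : ℝ) = Q.card - 1 := by
      rw [Finset.card_erase_of_mem hi, Nat.cast_sub (Finset.card_pos.2 ⟨i, hi⟩), Nat.cast_one]
    rw [h3, h2] at h1
    rw [← Finset.add_sum_erase Q (fun k => A i k) hi]
    linarith [hA i i]

lemma norm_sum_sq_le {ι : Type*} (s : Finset ι) (f : ι → ℂ) :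
    ‖∑ i ∈ s, f i‖ ^ 2 ≤ s.card * ∑ i ∈ s, ‖f i‖ ^ 2 := by
  calc ‖∑ i ∈ s, f i‖ ^ 2 ≤ (∑ i ∈ s, ‖f i‖) ^ 2 := by gcongr; exact norm_sum_le _ _
    _ ≤ _ := sq_sum_le_card_mul_sum_sq

/-! ### Averages of an additive character over a multiplicative group -/

/-- The mean of `g ↦ ψ (g z)` over a finite group `G` mapping to a field by `e`. -/
noncomputable def charMean {F G : Type*} [Field F] [CommGroup G] [Fintype G] (ψ : AddChar F ℂ)
    (e : G →* F) (z : F) : ℂ :=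
  (∑ g, ψ (e g * z)) / Fintype.card G

/-- The squared modulus of `charMean`. -/
noncomputable def charMeanSq {F G : Type*} [Field F] [CommGroup G] [Fintype G]
    (ψ : AddChar F ℂ) (e : G →* F) (z : F) : ℝ :=
  ‖charMean ψ e z‖ ^ 2

section charMean

lemma monoidHom_group_ne_zero {F G : Type*} [Field F] [CommGroup G] (e : G →* F) (g : G) :
    e g ≠ 0 := by
  intro h
  have : e g * e g⁻¹ = 1 := by rw [← map_mul, mul_inv_cancel, map_one]
  rw [h, zero_mul] at this
  exact zero_ne_one this

variable {F G : Type*} [Field F] [CommGroup G] [Fintype G] (ψ : AddChar F ℂ) (e : G →* F)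

lemma card_mul_charMean (z : F) :
    (Fintype.card G : ℂ) * charMean ψ e z = ∑ g, ψ (e g * z) := by
  rw [charMean, mul_div_cancel₀]
  exact_mod_cast Fintype.card_ne_zero

lemma charMean_mul (g : G) (z : F) : charMean ψ e (e g * z) = charMean ψ e z := by
  unfold charMean
  congr 1
  refine Fintype.sum_equiv (Equiv.mulRight g) _ _ fun x => ?_
  rw [Equiv.coe_mulRight, map_mul e, mul_assoc]

lemma charMeanSq_mul (g : G) (z : F) : charMeanSq ψ e (e g * z) = charMeanSq ψ e z := by
  rw [charMeanSq, charMean_mul, charMeanSq]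

lemma charMeanSq_nonneg (z : F) : 0 ≤ charMeanSq ψ e z := sq_nonneg _

lemma sum_charMeanSq_shift (c : G) : ∑ b, charMeanSq ψ e (e b + e c) =
    ∑ t, charMeanSq ψ e (1 + e t) := by
  refine Fintype.sum_equiv ((Equiv.inv G).trans (Equiv.mulRight c)) _ _ fun b => ?_
  rw [← charMeanSq_mul ψ e b (1 + _)]
  simp [mul_add, ← map_mul]

/-- By invariance `g` acts freely on the argument, and `ψ (g (1 + t))` factors; summing over `t` and
then `g` gives a product of two means. The three-term version is the same. -/
lemma sum_charMean_one_add : ∑ t, charMean ψ e (1 + e t) =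
    Fintype.card G * charMean ψ e 1 ^ 2 := by
  have hN : (Fintype.card G : ℂ) ≠ 0 := by exact_mod_cast Fintype.card_ne_zero
  have h : ∀ g : G, ∑ t, ψ (e g * (1 + e t)) =
      ψ (e g) * ((Fintype.card G : ℂ) * charMean ψ e 1) := by
    intro g
    rw [← charMean_mul ψ e g, card_mul_charMean, Finset.mul_sum]
    refine Finset.sum_congr rfl fun t _ => ?_
    rw [mul_add, AddChar.map_add_eq_mul, mul_one, mul_comm (e t)]
  unfold charMean at h ⊢
  rw [← Finset.sum_div, Finset.sum_comm, Finset.sum_congr rfl fun g _ => h g, ← Finset.sum_mul]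
  simp only [mul_one]
  field_simp

lemma sum_charMean_one_add_add : ∑ g, ∑ h, charMean ψ e (1 + e g + e h) =
    Fintype.card G ^ 2 * charMean ψ e 1 ^ 3 := by
  have hN : (Fintype.card G : ℂ) ≠ 0 := by exact_mod_cast Fintype.card_ne_zero
  have h : ∀ k : G, ∑ g, ∑ h, ψ (e k * (1 + e g + e h)) =
      ψ (e k) * ((Fintype.card G : ℂ) * charMean ψ e 1) ^ 2 := by
    intro k
    rw [← charMean_mul ψ e k, card_mul_charMean, sq, Finset.sum_mul_sum, Finset.mul_sum]
    refine Finset.sum_congr rfl fun g _ => ?_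
    rw [Finset.mul_sum]
    refine Finset.sum_congr rfl fun t _ => ?_
    rw [mul_add, mul_add, AddChar.map_add_eq_mul, AddChar.map_add_eq_mul, mul_one,
      mul_comm (e t), mul_comm (e g), mul_assoc]
  unfold charMean at h ⊢
  simp only [← Finset.sum_div]
  rw [Finset.sum_congr rfl fun g _ => Finset.sum_comm, Finset.sum_comm,
    Finset.sum_congr rfl fun k _ => h k, ← Finset.sum_mul]
  simp only [mul_one]
  field_simp

lemma le_sum_charMeanSq_one_add : Fintype.card G * ‖charMean ψ e 1‖ ^ 4 ≤
    ∑ t, charMeanSq ψ e (1 + e t) := by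
  have hN : (0 : ℝ) < Fintype.card G := by exact_mod_cast Fintype.card_pos
  have h := norm_sum_sq_le Finset.univ fun t : G => charMean ψ e (1 + e t)
  rw [sum_charMean_one_add, norm_mul, norm_pow, Complex.norm_natCast, Finset.card_univ] at h
  refine le_of_mul_le_mul_left ?_ hN
  calc _ = _ := by ring
    _ ≤ _ := h

lemma le_sum_charMeanSq_one_add_add : Fintype.card G ^ 2 * ‖charMean ψ e 1‖ ^ 6 ≤
    ∑ g, ∑ h, charMeanSq ψ e (1 + e g + e h) := by
  have hN : (0 : ℝ) < Fintype.card G := by exact_mod_cast Fintype.card_pos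
  have h := norm_sum_sq_le Finset.univ fun t : G × G => charMean ψ e (1 + e t.1 + e t.2)
  rw [Fintype.sum_prod_type, Fintype.sum_prod_type, sum_charMean_one_add_add, norm_mul, norm_pow,
    norm_pow, Complex.norm_natCast, Finset.card_univ, Fintype.card_prod, Nat.cast_mul] at h
  refine le_of_mul_le_mul_left ?_ (pow_pos hN 2)
  calc _ = _ := by ring
    _ ≤ _ := h
    _ = _ := by rw [sq]; rfl

variable [Fintype F]

lemma norm_charMean_le_one (z : F) : ‖charMean ψ e z‖ ≤ 1 := by
  have hN : (0 : ℝ) < Fintype.card G := by exact_mod_cast Fintype.card_pos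
  rw [charMean, norm_div, Complex.norm_natCast, div_le_one hN]
  refine (norm_sum_le _ _).trans ?_
  simp

lemma charMeanSq_le_one (z : F) : charMeanSq ψ e z ≤ 1 :=
  pow_le_one₀ (norm_nonneg _) (norm_charMean_le_one ψ e z)

lemma charMeanSq_eq_sum (z : F) : (charMeanSq ψ e z : ℂ) =
    (∑ g, ∑ h, ψ ((e g - e h) * z)) / ((Fintype.card G : ℝ) ^ 2 : ℝ) := by
  rw [charMeanSq]
  push_cast
  rw [← Complex.mul_conj', charMean, map_div₀, Complex.conj_natCast, div_mul_div_comm, map_sum,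
    Finset.sum_mul_sum, sq]
  congr 1
  refine Finset.sum_congr rfl fun g _ => Finset.sum_congr rfl fun h _ => ?_
  rw [sub_mul, sub_eq_add_neg, AddChar.map_add_eq_mul, AddChar.map_neg_eq_conj]

/-- Expanding the square gives the characters `z ↦ ψ ((g - h) z)`, each with weight `1 / N ^ 2`. -/
lemma isCharMixture_charMeanSq : IsCharMixture (fun z => (charMeanSq ψ e z : ℂ)) := by
  simp only [charMeanSq_eq_sum]
  refine IsCharMixture.div_real ?_ (by positivity)
  refine IsCharMixture.sum _ fun g _ => IsCharMixture.sum _ fun h _ => ?_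
  exact ⟨Unit, inferInstance, fun _ => 1, fun _ => ψ.mulShift (e g - e h), fun _ => zero_le_one,
    fun p => by simp [AddChar.mulShift_apply]⟩

lemma sum_charMeanSq (hψ : ψ.IsPrimitive) (he : Function.Injective e) :
    ∑ z, charMeanSq ψ e z = Fintype.card F / Fintype.card G := by
  classical
  have hN : (Fintype.card G : ℂ) ≠ 0 := by exact_mod_cast Fintype.card_ne_zero
  have : ((∑ z, charMeanSq ψ e z : ℝ) : ℂ) = ((Fintype.card F / Fintype.card G : ℝ) : ℂ) := by
    push_cast
    simp only [charMeanSq_eq_sum]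
    rw [← Finset.sum_div, Finset.sum_comm, Finset.sum_congr rfl fun g _ => Finset.sum_comm]
    have h1 : ∀ g h : G, ∑ z, ψ ((e g - e h) * z) = if g = h then (Fintype.card F : ℂ) else 0 := by
      intro g h
      have := AddChar.sum_mulShift (e g - e h) hψ
      simp only [mul_comm _ (e g - e h), sub_eq_zero, he.eq_iff] at this
      rw [this]
      push_cast
      rfl
    simp only [h1, Finset.sum_ite_eq, Finset.mem_univ, if_true, Finset.sum_const,
      Finset.card_univ, nsmul_eq_mul]
    push_cast
    field_simp
  exact_mod_cast this

/-- The square mean at `1` is bounded by Parseval's identity. -/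
lemma card_mul_norm_charMean_sq_le (hψ : ψ.IsPrimitive) (he : Function.Injective e) :
    Fintype.card G * ‖charMean ψ e 1‖ ^ 2 ≤ Fintype.card F / Fintype.card G := by
  classical
  rw [← sum_charMeanSq ψ e hψ he]
  calc (Fintype.card G : ℝ) * ‖charMean ψ e 1‖ ^ 2
      = ∑ g : G, charMeanSq ψ e (e g) := by
        rw [Finset.sum_congr rfl fun g _ => by
          rw [← mul_one (e g), charMeanSq_mul, charMeanSq], Finset.sum_const, Finset.card_univ,
          nsmul_eq_mul]
    _ = ∑ z ∈ Finset.univ.image e, charMeanSq ψ e z :=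
        (Finset.sum_image fun _ _ _ _ h => he h).symm
    _ ≤ _ := Finset.sum_le_univ_sum_of_nonneg fun z => charMeanSq_nonneg ψ e z

end charMean

/-! ### The weighted graph on `G` and the choice of shifts -/

section shifts

variable {F G : Type*} [Field F] [CommGroup G] [Fintype G] (ψ : AddChar F ℂ)
  (e : G →* F)

/-- The weight of the pair `(g, h)` in the graph attached to the shifts `b₁, b₂`. -/
noncomputable def shiftWeight (b₁ b₂ g h : G) : ℝ :=
  charMeanSq ψ e (1 + e g + e h) * charMeanSq ψ e (e b₁ + e g * e h) *
    charMeanSq ψ e (e b₂ + e g * e h)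

/-- By invariance the sum over each shift does not depend on `g h`, so the total factors; the
exponent is `14 = 6 + 4 + 4`. -/
lemma le_sum_shiftWeight : (Fintype.card G : ℝ) ^ 4 * ‖charMean ψ e 1‖ ^ 14 ≤
    ∑ b₁, ∑ b₂, ∑ g, ∑ h, shiftWeight ψ e b₁ b₂ g h := by
  set T := ∑ t, charMeanSq ψ e (1 + e t)
  have h1 : ∑ b₁, ∑ b₂, ∑ g, ∑ h, shiftWeight ψ e b₁ b₂ g h =
      (∑ g, ∑ h, charMeanSq ψ e (1 + e g + e h)) * T ^ 2 := by
    rw [Finset.sum_congr rfl fun b₁ _ => Finset.sum_comm, Finset.sum_comm, Finset.sum_mul]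
    refine Finset.sum_congr rfl fun g _ => ?_
    rw [Finset.sum_congr rfl fun b₁ _ => Finset.sum_comm, Finset.sum_comm, Finset.sum_mul]
    refine Finset.sum_congr rfl fun h _ => ?_
    have h2 : ∑ b, charMeanSq ψ e (e b + e g * e h) = T := by
      rw [← map_mul]
      exact sum_charMeanSq_shift ψ e (g * h)
    rw [sq]
    nth_rewrite 1 [← h2]
    rw [← h2, Finset.sum_mul_sum, Finset.mul_sum]
    refine Finset.sum_congr rfl fun b₁ _ => ?_
    rw [Finset.mul_sum]
    refine Finset.sum_congr rfl fun b₂ _ => ?_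
    rw [shiftWeight, mul_assoc]
  rw [h1]
  calc (Fintype.card G : ℝ) ^ 4 * ‖charMean ψ e 1‖ ^ 14
      = (Fintype.card G ^ 2 * ‖charMean ψ e 1‖ ^ 6) *
          (Fintype.card G * ‖charMean ψ e 1‖ ^ 4) ^ 2 := by ring
    _ ≤ _ := by
      have h2 := le_sum_charMeanSq_one_add ψ e
      have h3 := le_sum_charMeanSq_one_add_add ψ e
      exact mul_le_mul h3 (pow_le_pow_left₀ (by positivity) h2 2) (by positivity)
        ((by positivity : (0 : ℝ) ≤ _).trans h3)

/-- Pairs with ratio in `B` contribute at most half of the lower bound for the total weight. If all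
the others were below the threshold they would contribute at most a quarter. -/
lemma exists_shifts [Finite F] [DecidableEq G] (B : Finset G) (hμ : 0 < ‖charMean ψ e 1‖)
    (hB : 2 * (B.card : ℝ) ≤ Fintype.card G * ‖charMean ψ e 1‖ ^ 14) :
    ∃ b₁ b₂ : G, b₂ / b₁ ∉ B ∧ Fintype.card G * ‖charMean ψ e 1‖ ^ 14 / 4 * Fintype.card G <
      ∑ g, ∑ h, shiftWeight ψ e b₁ b₂ g h := by
  by_contra! hcon
  have := Fintype.ofFinite F
  have hN : (0 : ℝ) < Fintype.card G := by exact_mod_cast Fintype.card_pos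
  set N : ℝ := (Fintype.card G : ℝ)
  set μ := ‖charMean ψ e 1‖
  have h1 : ∀ b₁ b₂ : G, ∑ g, ∑ h, shiftWeight ψ e b₁ b₂ g h ≤
      (if b₂ / b₁ ∈ B then N ^ 2 else 0) + N * μ ^ 14 / 4 * N := by
    intro b₁ b₂
    split_ifs with h
    · have h2 : ∑ g, ∑ h, shiftWeight ψ e b₁ b₂ g h ≤ ∑ g : G, ∑ h : G, (1 : ℝ) := by
        refine Finset.sum_le_sum fun g _ => Finset.sum_le_sum fun h _ => ?_
        refine mul_le_one₀ (mul_le_one₀ ?_ ?_ ?_) ?_ ?_ <;>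
          first | exact charMeanSq_le_one ψ e _ | exact charMeanSq_nonneg ψ e _
      have h3 : ∑ g : G, ∑ h : G, (1 : ℝ) = N ^ 2 := by simp [N, sq]
      have : 0 ≤ N * μ ^ 14 / 4 * N := by positivity
      linarith
    · linarith [hcon b₁ b₂ h]
  have h2 := (le_sum_shiftWeight ψ e).trans
    (Finset.sum_le_sum fun b₁ _ => Finset.sum_le_sum fun b₂ _ => h1 b₁ b₂)
  have h3 : ∀ b₁ : G, ∑ b₂, (if b₂ / b₁ ∈ B then N ^ 2 else 0) = B.card * N ^ 2 := by
    intro b₁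
    rw [Fintype.sum_equiv (Equiv.divRight b₁) _ (fun x => if x ∈ B then N ^ 2 else 0)
      fun x => by simp]
    simp
  simp only [Finset.sum_add_distrib, h3, Finset.sum_const, Finset.card_univ, nsmul_eq_mul] at h2
  change N ^ 4 * μ ^ 14 ≤ N * (B.card * N ^ 2) + N * (N * (N * μ ^ 14 / 4 * N)) at h2
  have h4 : N ^ 3 * (2 * B.card) ≤ N ^ 3 * (N * μ ^ 14) := by gcongr
  have h5 : 0 < N ^ 4 * μ ^ 14 := by positivity
  nlinarith

end shifts

/-! ### Sets stable under an affine group -/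

/-- The translations preserving `V` form an additive group, and conjugating by `r ↦ l r` makes it
stable under multiplication by `l`, hence a module over the ring generated by `l`, which is `F`. It
is nonzero because it contains `l - 1`. -/
lemma eq_univ_of_stable {F : Type*} [Field F] [Finite F] {V : Set F} (hV : V.Nonempty) {l : F}
    (hl0 : l ≠ 0) (hl1 : l ≠ 1) (hl : Subring.closure {l} = ⊤) (hmul : ∀ r ∈ V, l * r ∈ V)
    (hneg : ∀ r ∈ V, -(1 + r) ∈ V) : V = Set.univ := by
  have hinv : ∀ r ∈ V, l⁻¹ * r ∈ V := by
    obtain ⟨k, hk, hk'⟩ := isOfFinOrder_iff_pow_eq_one.1 (isOfFinOrder_of_finite (Units.mk0 l hl0))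
    have hk'' : l ^ k = 1 := by simpa using congrArg Units.val hk'
    have hpow : ∀ n : ℕ, ∀ r ∈ V, l ^ n * r ∈ V := by
      intro n
      induction n with
      | zero => intro r hr; simpa using hr
      | succ n ih => intro r hr; rw [pow_succ, mul_assoc]; exact ih _ (hmul r hr)
    have : l⁻¹ = l ^ (k - 1) := by
      refine inv_eq_of_mul_eq_one_right ?_
      rw [← pow_succ', Nat.sub_add_cancel hk, hk'']
    rw [this]
    exact hpow _
  have hadd : ∀ x y : F, (∀ r ∈ V, x + r ∈ V) → (∀ r ∈ V, y + r ∈ V) → ∀ r ∈ V, x + y + r ∈ V := by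
    intro x y hx hy r hr
    rw [add_assoc]
    exact hx _ (hy r hr)
  have hneg' : ∀ x : F, (∀ r ∈ V, x + r ∈ V) → ∀ r ∈ V, -x + r ∈ V := by
    intro x hx r hr
    obtain ⟨k, hk, hk'⟩ := isOfFinAddOrder_iff_nsmul_eq_zero.1 (isOfFinAddOrder_of_finite x)
    have hsm : ∀ n : ℕ, ∀ r ∈ V, n • x + r ∈ V := by
      intro n
      induction n with
      | zero => intro r hr; simpa using hr
      | succ n ih => intro r hr; rw [succ_nsmul, add_assoc]; exact ih _ (hx r hr)
    have : -x = (k - 1) • x := by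
      rw [neg_eq_iff_add_eq_zero, ← succ_nsmul', Nat.sub_add_cancel hk, hk']
    rw [this]
    exact hsm _ r hr
  have hscale : ∀ t ∈ Subring.closure {l}, ∀ d, (∀ r ∈ V, d + r ∈ V) → ∀ r ∈ V, t * d + r ∈ V := by
    intro t ht
    induction ht using Subring.closure_induction with
    | mem x hx =>
      intro d hd r hr
      rw [Set.mem_singleton_iff.1 hx]
      have : l * d + r = l * (d + l⁻¹ * r) := by field_simp
      rw [this]
      exact hmul _ (hd _ (hinv r hr))
    | zero => intro d _ r hr; simpa using hr
    | one => intro d hd r hr; simpa using hd r hr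
    | add x y _ _ hx hy =>
      intro d hd r hr
      rw [add_mul]
      exact hadd _ _ (hx d hd) (hy d hd) r hr
    | neg x _ hx =>
      intro d hd r hr
      rw [neg_mul]
      exact hneg' _ (hx d hd) r hr
    | mul x y _ _ hx hy =>
      intro d hd r hr
      rw [mul_assoc]
      exact hx _ (hy d hd) r hr
  have hbase : ∀ r ∈ V, (l - 1) + r ∈ V := by
    intro r hr
    -- The commutator-like word in the two maps is translation by `l - 1`.
    have h1 := hneg _ (hmul _ (hneg _ (hinv r hr)))
    have : -(1 + l * -(1 + l⁻¹ * r)) = (l - 1) + r := by field_simp; ring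
    rwa [this] at h1
  refine Set.eq_univ_of_forall fun x => ?_
  obtain ⟨r, hr⟩ := hV
  have h := hscale ((x - r) / (l - 1)) (by rw [hl]; trivial) (l - 1) hbase r hr
  rwa [div_mul_cancel₀ _ (sub_ne_zero.2 hl1), sub_add_cancel] at h

/-! ### Popular slopes and the bound for the mean -/

section ratios

variable {F G : Type*} [Field F] [CommGroup G] [Fintype G] (ψ : AddChar F ℂ)
  (e : G →* F)

/-- The positive definite function on `F × F` whose values at the points `(x, g x)` are the
normalised degrees in the graph `shiftWeight` restricted to `Q`. -/
noncomputable def pairMean (Q : Finset G) (b₁ b₂ : G) (p : F × F) : ℝ :=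
  (∑ h ∈ Q, charMeanSq ψ e ((1 + e h) * p.1 + 1 * p.2) *
    charMeanSq ψ e (e b₁ * p.1 + e h * p.2) * charMeanSq ψ e (e b₂ * p.1 + e h * p.2)) /
    Fintype.card G

variable (Q : Finset G) (b₁ b₂ : G)

lemma pairMean_nonneg (p : F × F) : 0 ≤ pairMean ψ e Q b₁ b₂ p := by
  refine div_nonneg (Finset.sum_nonneg fun h _ => ?_) (by positivity)
  exact mul_nonneg (mul_nonneg (charMeanSq_nonneg ψ e _) (charMeanSq_nonneg ψ e _))
    (charMeanSq_nonneg ψ e _)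

lemma pairMean_le_of_le {f : G → ℝ} {p : F × F}
    (hf : ∀ h ∈ Q, charMeanSq ψ e ((1 + e h) * p.1 + 1 * p.2) *
      charMeanSq ψ e (e b₁ * p.1 + e h * p.2) * charMeanSq ψ e (e b₂ * p.1 + e h * p.2) ≤ f h) :
    pairMean ψ e Q b₁ b₂ p ≤ (∑ h ∈ Q, f h) / Fintype.card G := by
  unfold pairMean
  gcongr with h hh
  exact hf h hh

lemma pairMean_mul (g : G) (p : F × F) :
    pairMean ψ e Q b₁ b₂ (e g * p.1, e g * p.2) = pairMean ψ e Q b₁ b₂ p := by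
  unfold pairMean
  congr 1
  refine Finset.sum_congr rfl fun h _ => ?_
  have key : ∀ a b : F, charMeanSq ψ e (a * (e g * p.1) + b * (e g * p.2)) =
      charMeanSq ψ e (a * p.1 + b * p.2) := by
    intro a b
    rw [← charMeanSq_mul ψ e g (a * p.1 + b * p.2)]
    congr 1
    ring
  simp only [key]

lemma pairMean_one (g : G) :
    pairMean ψ e Q b₁ b₂ (1, e g) = (∑ h ∈ Q, shiftWeight ψ e b₁ b₂ g h) / Fintype.card G := by
  unfold pairMean shiftWeight
  congr 1
  refine Finset.sum_congr rfl fun h _ => ?_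
  simp only [mul_one, one_mul, add_right_comm, mul_comm (e h)]

variable [Fintype F]

lemma isCharMixture_charMeanSq_linear (a b : F) :
    IsCharMixture (fun p : F × F => (charMeanSq ψ e (a * p.1 + b * p.2) : ℂ)) :=
  (isCharMixture_charMeanSq ψ e).comp
    ((AddMonoidHom.mulLeft a).coprod (AddMonoidHom.mulLeft b))

lemma isCharMixture_pairMean : IsCharMixture (fun p => (pairMean ψ e Q b₁ b₂ p : ℂ)) := by
  have h : IsCharMixture (fun p : F × F => (∑ h ∈ Q,
      ((charMeanSq ψ e ((1 + e h) * p.1 + 1 * p.2) : ℂ) *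
      (charMeanSq ψ e (e b₁ * p.1 + e h * p.2) : ℂ) *
      (charMeanSq ψ e (e b₂ * p.1 + e h * p.2) : ℂ))) / ((Fintype.card G : ℝ) : ℂ)) := by
    refine IsCharMixture.div_real ?_ (by positivity)
    refine IsCharMixture.sum _ fun h _ => ?_
    exact ((isCharMixture_charMeanSq_linear ψ e _ _).mul
      (isCharMixture_charMeanSq_linear ψ e _ _)).mul (isCharMixture_charMeanSq_linear ψ e _ _)
  simpa [pairMean] using h

lemma pairMean_le_one (p : F × F) : pairMean ψ e Q b₁ b₂ p ≤ 1 := by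
  have hN : (0 : ℝ) < Fintype.card G := by exact_mod_cast Fintype.card_pos
  refine (pairMean_le_of_le ψ e Q b₁ b₂ (f := fun _ => 1) fun h _ => ?_).trans ?_
  · refine mul_le_one₀ (mul_le_one₀ ?_ ?_ ?_) ?_ ?_ <;>
      first | exact charMeanSq_le_one ψ e _ | exact charMeanSq_nonneg ψ e _
  · rw [div_le_one hN]
    simpa using Finset.card_le_univ Q

/-- After dropping the first factor, `(x, y) ↦ (b₁ x + h y, b₂ x + h y)` is a bijection because `b₁
≠ b₂`, so Parseval applies in each coordinate. -/
lemma sum_pairMean_le (hψ : ψ.IsPrimitive) (he : Function.Injective e) (hb : b₁ ≠ b₂) :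
    ∑ p, pairMean ψ e Q b₁ b₂ p ≤ ((Fintype.card F : ℝ) / Fintype.card G) ^ 2 := by
  have hN : (0 : ℝ) < Fintype.card G := by exact_mod_cast Fintype.card_pos
  have hb' : e b₁ - e b₂ ≠ 0 := sub_ne_zero.2 fun h => hb (he h)
  have h1 : ∀ h : G, ∑ p : F × F, charMeanSq ψ e (e b₁ * p.1 + e h * p.2) *
      charMeanSq ψ e (e b₂ * p.1 + e h * p.2) = ((Fintype.card F : ℝ) / Fintype.card G) ^ 2 := by
    intro h
    have hbij : Function.Bijective fun p : F × F =>
        (e b₁ * p.1 + e h * p.2, e b₂ * p.1 + e h * p.2) := by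
      rw [← Finite.injective_iff_bijective]
      rintro ⟨x, y⟩ ⟨x', y'⟩ hxy
      simp only [Prod.mk.injEq] at hxy ⊢
      have hx : x = x' := by
        have : (e b₁ - e b₂) * (x - x') = 0 := by linear_combination hxy.1 - hxy.2
        exact sub_eq_zero.1 ((mul_eq_zero.1 this).resolve_left hb')
      refine ⟨hx, ?_⟩
      subst hx
      exact mul_left_cancel₀ (monoidHom_group_ne_zero e h) (add_left_cancel hxy.1)
    rw [Fintype.sum_bijective _ hbij _ (fun p : F × F => charMeanSq ψ e p.1 * charMeanSq ψ e p.2)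
      fun p => rfl, Fintype.sum_prod_type, ← Finset.sum_mul_sum, sum_charMeanSq ψ e hψ he, sq]
  calc ∑ p, pairMean ψ e Q b₁ b₂ p
      ≤ ∑ p : F × F, (∑ h ∈ Q, charMeanSq ψ e (e b₁ * p.1 + e h * p.2) *
          charMeanSq ψ e (e b₂ * p.1 + e h * p.2)) / Fintype.card G := by
        refine Finset.sum_le_sum fun p _ => pairMean_le_of_le ψ e Q b₁ b₂ fun h _ => ?_
        rw [mul_assoc]
        exact mul_le_of_le_one_left
          (mul_nonneg (charMeanSq_nonneg ψ e _) (charMeanSq_nonneg ψ e _))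
          (charMeanSq_le_one ψ e _)
    _ = Q.card / Fintype.card G * ((Fintype.card F : ℝ) / Fintype.card G) ^ 2 := by
        rw [← Finset.sum_div, Finset.sum_comm, Finset.sum_congr rfl fun h _ => h1 h,
          Finset.sum_const, nsmul_eq_mul]
        ring
    _ ≤ 1 * _ := by
        gcongr
        rw [div_le_one hN]
        exact_mod_cast Finset.card_le_univ Q
    _ = _ := one_mul _

/-- If `-α / β` is not the slope of a popular difference, then `(x, y) ↦ α x + β y` has small
fibres on the pairs `(x, g x)`, `g ∈ Q`. -/
lemma sum_charMeanSq_le_of_slope (hψ : ψ.IsPrimitive) (he : Function.Injective e) {c : ℝ}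
    (hc : 0 < c) (hQ : ∀ g ∈ Q, c ≤ pairMean ψ e Q b₁ b₂ (1, e g)) {α β : F}
    (hβ : β ≠ 0) (hslope : ∀ p : F × F, p.1 ≠ 0 → p.2 = -α / β * p.1 →
      pairMean ψ e Q b₁ b₂ p ≤ c ^ 2 / 2) :
    Fintype.card G * ∑ h ∈ Q, charMeanSq ψ e (α + β * e h) ≤
      2 / c ^ 2 * (Fintype.card F / Fintype.card G) := by
  classical
  let f : G × G → F := fun i => e i.1 * (α + β * e i.2)
  let P : Finset (G × G) := Finset.univ ×ˢ Q
  have h1 : Fintype.card G * ∑ h ∈ Q, charMeanSq ψ e (α + β * e h) =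
      ∑ i ∈ P, charMeanSq ψ e (f i) := by
    rw [Finset.sum_product]
    simp only [f, charMeanSq_mul, Finset.sum_const, Finset.card_univ, nsmul_eq_mul]
  -- Two points `(x, g x)` in one fibre differ by a point of slope `-α / β`, which is unpopular by
  -- assumption; `IsCharMixture.card_le` then bounds the fibre.
  have h2 : ∀ z : F, ((P.filter fun i => f i = z).card : ℝ) ≤ 2 / c ^ 2 := by
    intro z
    let k : G × G → F × F := fun i => (e i.1, e i.1 * e i.2)
    have hk : Function.Injective k := by
      rintro ⟨x, g⟩ ⟨x', g'⟩ h
      simp only [k, Prod.mk.injEq] at h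
      have hx := he h.1
      subst hx
      exact Prod.ext rfl (he (mul_left_cancel₀ (monoidHom_group_ne_zero e x) h.2))
    rw [← Finset.card_image_of_injective _ hk]
    refine (isCharMixture_pairMean ψ e Q b₁ b₂).card_le (pairMean_le_one ψ e Q b₁ b₂)
      (pairMean_nonneg ψ e Q b₁ b₂ 0) hc _ ?_ ?_
    · intro p hp
      obtain ⟨⟨x, g⟩, hi, rfl⟩ := Finset.mem_image.1 hp
      have hg : g ∈ Q := (Finset.mem_product.1 (Finset.mem_filter.1 hi).1).2
      have := pairMean_mul ψ e Q b₁ b₂ x (1, e g)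
      simp only [mul_one] at this
      simp only [k, this]
      exact hQ g hg
    · intro p hp p' hp' hne
      obtain ⟨⟨x, g⟩, hi, rfl⟩ := Finset.mem_image.1 hp
      obtain ⟨⟨x', g'⟩, hi', rfl⟩ := Finset.mem_image.1 hp'
      have hz := (Finset.mem_filter.1 hi).2.trans (Finset.mem_filter.1 hi').2.symm
      simp only [f] at hz
      have hlin : α * (e x - e x') + β * (e x * e g - e x' * e g') = 0 := by
        linear_combination hz
      refine hslope _ ?_ ?_
      · intro h0
        simp only [k, Prod.fst_sub] at h0
        rw [h0, mul_zero, zero_add] at hlin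
        exact hne (Prod.ext (sub_eq_zero.1 h0)
          (sub_eq_zero.1 ((mul_eq_zero.1 hlin).resolve_left hβ)))
      · simp only [k, Prod.fst_sub, Prod.snd_sub]
        field_simp
        linear_combination hlin
  rw [h1, ← sum_charMeanSq ψ e hψ he, Finset.mul_sum,
    ← Finset.sum_fiberwise_of_maps_to (s := P) (t := Finset.univ) (g := f)
      fun i _ => Finset.mem_univ _]
  refine Finset.sum_le_sum fun z _ => ?_
  rw [Finset.sum_congr rfl fun i hi => by rw [(Finset.mem_filter.1 hi).2], Finset.sum_const,
    nsmul_eq_mul]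
  exact mul_le_mul_of_nonneg_right (h2 z) (charMeanSq_nonneg ψ e z)

/-- The key estimate: if all points of `Q` have large degree in the graph of the shifts `b₁, b₂`
whose ratio generates the field, then the group is small. -/
lemma card_pow_three_mul_le (hψ : ψ.IsPrimitive) (he : Function.Injective e)
    (hb1 : b₂ / b₁ ≠ 1) (hb : Subring.closure {e (b₂ / b₁)} = ⊤) {c : ℝ} (hc : 0 < c)
    (hQn : Q.Nonempty) (hQ : ∀ g ∈ Q, c ≤ pairMean ψ e Q b₁ b₂ (1, e g)) :
    (Fintype.card G : ℝ) ^ 3 * c ^ 4 ≤ 4 * Fintype.card F := by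
  classical
  by_contra! hbig
  have hN : (0 : ℝ) < Fintype.card G := by exact_mod_cast Fintype.card_pos
  have hq : (2 : ℝ) ≤ Fintype.card F := by exact_mod_cast Fintype.one_lt_card (α := F)
  set N : ℝ := (Fintype.card G : ℝ) with hN_def
  set q : ℝ := (Fintype.card F : ℝ) with hq_def
  let R : Set F := {r | r ≠ 0 ∧ ∃ u, u ≠ 0 ∧ c ^ 2 / 2 ≤ pairMean ψ e Q b₁ b₂ (u, r * u)}
  -- Otherwise the small-fibre estimate would give `N ^ 3 * c ^ 4 ≤ 4 * q`.
  have hslope : ∀ α β : F, α ≠ 0 → β ≠ 0 →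
      c ^ 2 / 2 ≤ (∑ h ∈ Q, charMeanSq ψ e (α + β * e h)) / N → -α / β ∈ R := by
    intro α β hα hβ h
    by_contra hR
    have h1 := sum_charMeanSq_le_of_slope ψ e Q b₁ b₂ hψ he hc hQ hβ fun p hp1 hp2 => by
      by_contra! hlt
      refine hR ⟨div_ne_zero (neg_ne_zero.2 hα) hβ, p.1, hp1, ?_⟩
      rw [← hp2]
      exact hlt.le
    rw [← hN_def, ← hq_def] at h1
    rw [le_div_iff₀ hN] at h
    have h2 : N * (c ^ 2 / 2 * N) ≤ 2 / c ^ 2 * (q / N) := (by gcongr : _ ≤ _).trans h1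
    have h3 : 2 / c ^ 2 * (q / N) * (2 * c ^ 2 * N) = 4 * q := by field_simp; ring
    have h4 := mul_le_mul_of_nonneg_right h2 (by positivity : 0 ≤ 2 * c ^ 2 * N)
    rw [h3] at h4
    linarith [(by ring : N * (c ^ 2 / 2 * N) * (2 * c ^ 2 * N) = N ^ 3 * c ^ 4)]
  have hw0 := charMeanSq_nonneg ψ e
  have hw1 := charMeanSq_le_one ψ e
  -- At `(u, r u)` the first factor is `w ((1 + r) u + u h)`. Bounding the other two by `1` makes
  -- its mean popular. The next two claims keep the second and the third factor instead.
  have hneg : ∀ r ∈ R, r ≠ -1 → -(1 + r) ∈ R := by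
    rintro r ⟨hr0, u, hu, hru⟩ hr1
    have h1r : 1 + r ≠ 0 := fun h => hr1 (by linear_combination h)
    have := hslope ((1 + r) * u) u (mul_ne_zero h1r hu) hu
      (hru.trans (pairMean_le_of_le ψ e Q b₁ b₂ fun h _ => ?_))
    · rwa [neg_div, mul_div_cancel_right₀ _ hu] at this
    · rw [mul_assoc]
      refine (mul_le_of_le_one_right (hw0 _) (mul_le_one₀ (hw1 _) (hw0 _) (hw1 _))).trans
        (le_of_eq ?_)
      congr 1
      ring
  have hdiv1 : ∀ r ∈ R, -(e b₁) / r ∈ R := by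
    rintro r ⟨hr0, u, hu, hru⟩
    have hb₁ := monoidHom_group_ne_zero e b₁
    have := hslope (e b₁ * u) (r * u) (mul_ne_zero hb₁ hu) (mul_ne_zero hr0 hu)
      (hru.trans (pairMean_le_of_le ψ e Q b₁ b₂ fun h _ => ?_))
    · rwa [← neg_mul, mul_div_mul_right _ _ hu] at this
    · refine (mul_le_of_le_one_right (mul_nonneg (hw0 _) (hw0 _)) (hw1 _)).trans
        ((mul_le_of_le_one_left (hw0 _) (hw1 _)).trans (le_of_eq ?_))
      congr 1
      ring
  have hdiv2 : ∀ r ∈ R, -(e b₂) / r ∈ R := by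
    rintro r ⟨hr0, u, hu, hru⟩
    have hb₂ := monoidHom_group_ne_zero e b₂
    have := hslope (e b₂ * u) (r * u) (mul_ne_zero hb₂ hu) (mul_ne_zero hr0 hu)
      (hru.trans (pairMean_le_of_le ψ e Q b₁ b₂ fun h _ => ?_))
    · rwa [← neg_mul, mul_div_mul_right _ _ hu] at this
    · refine (mul_le_of_le_one_left (hw0 _) (mul_le_one₀ (hw1 _) (hw0 _) (hw1 _))).trans
        (le_of_eq ?_)
      congr 1
      ring
  set l : F := e (b₂ / b₁) with hl
  have hl0 : l ≠ 0 := monoidHom_group_ne_zero e _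
  have hl1 : l ≠ 1 := fun h => hb1 (he (by rw [← hl, h, map_one]))
  have hlb : l * e b₁ = e b₂ := by rw [hl, ← map_mul, div_mul_cancel]
  have hmul : ∀ r ∈ R, l * r ∈ R := by
    intro r hr
    have h := hdiv2 _ (hdiv1 r hr)
    have hr0 := hr.1
    have hb₁ := monoidHom_group_ne_zero e b₁
    rw [← hlb] at h
    convert h using 1
    field_simp
  have hRn : R.Nonempty := by
    obtain ⟨g, hg⟩ := hQn
    refine ⟨e g, monoidHom_group_ne_zero e g, 1, one_ne_zero, ?_⟩
    rw [mul_one]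
    refine le_trans ?_ (hQ g hg)
    have : c ≤ 1 := (hQ g hg).trans (pairMean_le_one ψ e Q b₁ b₂ _)
    nlinarith
  have hall : ∀ r : F, r ≠ 0 → r ∈ R := by
    -- The map `r ↦ -(1 + r)` swaps `-1` and `0`, so `0` has to be adjoined when `-1` is a popular
    -- slope.
    by_cases h1 : (-1 : F) ∈ R
    · have : insert 0 R = Set.univ := by
        refine eq_univ_of_stable (Set.insert_nonempty _ _) hl0 hl1 hb ?_ ?_
        · rintro r (rfl | hr)
          · simp
          · exact Or.inr (hmul r hr)
        · rintro r (rfl | hr)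
          · exact Or.inr (by simpa using h1)
          · by_cases hr1 : r = -1
            · left; rw [hr1]; ring
            · exact Or.inr (hneg r hr hr1)
      intro r hr
      have hr' : r ∈ insert 0 R := by rw [this]; trivial
      exact hr'.resolve_left hr
    · have : R = Set.univ := eq_univ_of_stable hRn hl0 hl1 hb hmul fun r hr =>
        hneg r hr fun h => h1 (h ▸ hr)
      intro r _
      rw [this]
      trivial
  have hall' : ∀ r : Fˣ, ∃ u : F, u ≠ 0 ∧ c ^ 2 / 2 ≤ pairMean ψ e Q b₁ b₂ (u, (r : F) * u) :=
    fun r => (hall r r.ne_zero).2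
  choose u hu0 hu using hall'
  let k : Fˣ × G → F × F := fun i => (e i.2 * u i.1, e i.2 * (i.1 * u i.1))
  have hk : Function.Injective k := by
    rintro ⟨r, g⟩ ⟨r', g'⟩ h
    simp only [k, Prod.mk.injEq] at h
    have hr : (r : F) = r' := by
      refine mul_right_cancel₀ (mul_ne_zero (monoidHom_group_ne_zero e g) (hu0 r)) ?_
      linear_combination h.2 - r' * h.1
    have hr' := Units.ext hr
    subst hr'
    exact Prod.ext rfl (he (mul_right_cancel₀ (hu0 r) h.1))
  -- Each of the `q - 1` slopes has a popular point, and its `G`-orbit supplies `N` of them, all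
  -- distinct.
  have hlow : (q - 1) * N * (c ^ 2 / 2) ≤ (q / N) ^ 2 := by
    refine le_trans ?_ (sum_pairMean_le ψ e Q b₁ b₂ hψ he fun h => hb1 (by rw [h, div_self']))
    calc (q - 1) * N * (c ^ 2 / 2) = ∑ i : Fˣ × G, c ^ 2 / 2 := by
          rw [Finset.sum_const, Finset.card_univ, nsmul_eq_mul, Fintype.card_prod,
            Fintype.card_units, Nat.cast_mul, Nat.cast_sub Fintype.card_pos, Nat.cast_one]
      _ ≤ ∑ i : Fˣ × G, pairMean ψ e Q b₁ b₂ (k i) := by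
          refine Finset.sum_le_sum fun i _ => ?_
          rw [pairMean_mul ψ e Q b₁ b₂ i.2 (u i.1, i.1 * u i.1)]
          exact hu i.1
      _ = ∑ p ∈ Finset.univ.image k, pairMean ψ e Q b₁ b₂ p :=
          (Finset.sum_image fun _ _ _ _ h => hk h).symm
      _ ≤ _ := Finset.sum_le_univ_sum_of_nonneg fun p => pairMean_nonneg ψ e Q b₁ b₂ p
  have hc1 : c ≤ 1 := by
    obtain ⟨g, hg⟩ := hQn
    exact (hQ g hg).trans (pairMean_le_one ψ e Q b₁ b₂ _)
  have h5 : N ^ 3 * c ^ 4 ≤ N ^ 3 * c ^ 2 := by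
    gcongr N ^ 3 * ?_
    exact pow_le_pow_of_le_one hc.le hc1 (by norm_num)
  rw [div_pow, le_div_iff₀ (by positivity)] at hlow
  have h6 : (q - 1) * (N ^ 3 * c ^ 2) ≤ 2 * q ^ 2 := by nlinarith
  have h7 : q / 2 * (4 * q) < (q - 1) * (N ^ 3 * c ^ 2) := by
    apply mul_lt_mul' <;> nlinarith
  nlinarith

/-- The bound for the mean of a nontrivial additive character over a multiplicative group. -/
theorem card_pow_three_mul_norm_charMean_le [DecidableEq G] (hψ : ψ.IsPrimitive)
    (he : Function.Injective e) (B : Finset G)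
    (hB : ∀ g ∉ B, g ≠ 1 ∧ Subring.closure {e g} = ⊤)
    (hBcard : 2 * (B.card : ℝ) ≤ Fintype.card G * ‖charMean ψ e 1‖ ^ 14) :
    (Fintype.card G : ℝ) ^ 3 * ‖charMean ψ e 1‖ ^ 56 ≤ 2 ^ 14 * Fintype.card F := by
  have hN : (0 : ℝ) < Fintype.card G := by exact_mod_cast Fintype.card_pos
  rcases (norm_nonneg (charMean ψ e 1)).eq_or_lt with hμ | hμ
  · rw [← hμ, zero_pow (by norm_num), mul_zero]
    positivity
  obtain ⟨b₁, b₂, hb, hlt⟩ := exists_shifts ψ e B hμ hBcard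
  obtain ⟨Q, hQn, hQ⟩ := exists_minDegree (shiftWeight ψ e b₁ b₂) (fun g h => by
    unfold shiftWeight
    rw [mul_comm (e h), add_right_comm]) (fun g h =>
      mul_nonneg (mul_nonneg (charMeanSq_nonneg ψ e _) (charMeanSq_nonneg ψ e _))
      (charMeanSq_nonneg ψ e _)) hlt
  -- The average degree `N * μ ^ 14 / 4` is halved by `exists_minDegree` and normalised by `N`. The
  -- final exponent is `4 * 14` and the constant is `4 * 8 ^ 4 = 2 ^ 14`.
  have h := card_pow_three_mul_le ψ e Q b₁ b₂ hψ he (hB _ hb).1 (hB _ hb).2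
    (c := ‖charMean ψ e 1‖ ^ 14 / 8) (by positivity) hQn fun g hg => by
      rw [pairMean_one, le_div_iff₀ hN]
      refine le_trans (le_of_eq ?_) (hQ g hg)
      ring
  linarith [(by ring : (Fintype.card G : ℝ) ^ 3 * (‖charMean ψ e 1‖ ^ 14 / 8) ^ 4 =
    (Fintype.card G : ℝ) ^ 3 * ‖charMean ψ e 1‖ ^ 56 / 4096)]

end ratios

/-! ### Elements of proper subfields -/

/-- An element generating a subfield of degree `ν` satisfies `x ^ p ^ ν = x`. Scalars from `ZMod p`
are integers and `x` is algebraic, so ring and field generation agree. -/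
lemma subring_closure_eq_top_of_pow_ne {p : ℕ} [Fact p.Prime] {F : Type*} [Field F] [Fintype F]
    [Algebra (ZMod p) F] {m : ℕ} (hF : Fintype.card F = p ^ m) {x : F}
    (hx : ∀ ν, 1 ≤ ν → ν < m → ν ∣ m → x ^ p ^ ν ≠ x) : Subring.closure {x} = ⊤ := by
  have hp := (Fact.out : p.Prime)
  let K := IntermediateField.adjoin (ZMod p) {x}
  have hm : Module.finrank (ZMod p) F = m := by
    have h := Module.card_eq_pow_finrank (K := ZMod p) (V := F)
    rw [hF, ZMod.card] at h
    exact (Nat.pow_right_injective hp.two_le h).symm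
  have hKtop : K = ⊤ := by
    by_contra hK
    have hle : Module.finrank (ZMod p) K ∣ m :=
      hm ▸ ⟨_, (Module.finrank_mul_finrank (ZMod p) K F).symm⟩
    have hpos : 0 < Module.finrank (ZMod p) K := Module.finrank_pos
    have hmpos : 0 < m := hm ▸ Module.finrank_pos
    have hne : Module.finrank (ZMod p) K ≠ m := by
      intro h
      refine hK (IntermediateField.eq_of_le_of_finrank_eq le_top ?_)
      rw [h, IntermediateField.finrank_top', hm]
    refine hx _ hpos (lt_of_le_of_ne (Nat.le_of_dvd hmpos hle) hne) hle ?_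
    have : Fintype K := Fintype.ofFinite K
    have h := FiniteField.pow_card (⟨x, IntermediateField.mem_adjoin_simple_self _ x⟩ : K)
    rw [Module.card_eq_pow_finrank (K := ZMod p) (V := K), ZMod.card] at h
    simpa using congrArg Subtype.val h
  let A : Subalgebra (ZMod p) F :=
    { Subring.closure {x} with
      algebraMap_mem' := fun r => by
        obtain ⟨k, rfl⟩ := ZMod.natCast_zmod_surjective r
        rw [map_natCast]
        exact natCast_mem (Subring.closure {x}) k }
  have hA : Algebra.adjoin (ZMod p) {x} ≤ A :=
    Algebra.adjoin_le (Set.singleton_subset_iff.2 (Subring.subset_closure rfl))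
  have hint : IsIntegral (ZMod p) x := Algebra.IsIntegral.isIntegral x
  rw [eq_top_iff]
  intro y _
  have hy : y ∈ K.toSubalgebra := by rw [hKtop]; trivial
  rw [IntermediateField.adjoin_simple_toSubalgebra_of_isAlgebraic hint.isAlgebraic] at hy
  exact hA hy

lemma card_pow_eq_one_le_gcd {G : Type*} [CommGroup G] [IsCyclic G] [Fintype G] [DecidableEq G]
    (k : ℕ) :
    (Finset.univ.filter fun g : G => g ^ k = 1).card ≤ (Fintype.card G).gcd k := by
  have hpos : 0 < (Fintype.card G).gcd k := Nat.gcd_pos_of_pos_left _ Fintype.card_pos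
  refine le_trans (Finset.card_le_card fun g hg => ?_) (IsCyclic.card_pow_eq_one_le hpos)
  simp only [Finset.mem_filter, Finset.mem_univ, true_and] at hg ⊢
  exact pow_gcd_eq_one.2 ⟨pow_card_eq_one, hg⟩

lemma gcd_div_le_of_subfieldGcdBound {κ : ℝ} {p m n : ℕ} [Fact p.Prime] (hκ : 0 ≤ κ)
    (hn : n ∣ p ^ m - 1) (hn0 : 0 < n) (h : SubfieldGcdBound κ p m n) {ν : ℕ} (hν1 : 1 ≤ ν)
    (hνm : ν < m) (hν : ν ∣ m) :
    (((p ^ m - 1) / n).gcd (p ^ ν - 1) : ℝ) ≤ κ * ((p ^ m : ℕ) : ℝ) ^ (1 / 4 : ℝ) := by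
  have hp := (Fact.out : p.Prime)
  have hp0 : (0 : ℝ) < p := by exact_mod_cast hp.pos
  have hp1 : (1 : ℝ) ≤ p := by exact_mod_cast hp.one_le
  have hn0' : (0 : ℝ) < n := by exact_mod_cast hn0
  obtain ⟨N, hN⟩ := hn
  obtain ⟨M, hM⟩ : p ^ ν - 1 ∣ p ^ m - 1 := Nat.pow_sub_one_dvd_pow_sub_one p hν
  have hk : 0 < p ^ ν - 1 := Nat.sub_pos_of_lt (Nat.one_lt_pow (by omega) hp.one_lt)
  have h1 := h ν hν1 hνm hν
  rw [hM, Nat.mul_div_cancel_left _ hk] at h1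
  rw [hN, Nat.mul_div_cancel_left _ hn0]
  -- Both sides are the gcd of `n * N = (p ^ ν - 1) * M` and `n * (p ^ ν - 1)`.
  have h2 : n * N.gcd (p ^ ν - 1) = (p ^ ν - 1) * n.gcd M := by
    rw [← Nat.gcd_mul_left, ← Nat.gcd_mul_left, ← hN, hM, Nat.gcd_comm, mul_comm n]
  have h3 : (n : ℝ) * (N.gcd (p ^ ν - 1) : ℝ) = ((p ^ ν - 1 : ℕ) : ℝ) * (n.gcd M : ℝ) := by
    exact_mod_cast h2
  have h4 : ((p ^ ν - 1 : ℕ) : ℝ) ≤ (p : ℝ) ^ ((ν : ℝ) / 2) * (p : ℝ) ^ ((ν : ℝ) / 2) := by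
    rw [← Real.rpow_add hp0, add_halves, Real.rpow_natCast]
    exact_mod_cast Nat.sub_le _ _
  have hx : (0 : ℝ) < (p : ℝ) ^ ((ν : ℝ) / 2) := Real.rpow_pos_of_pos hp0 _
  have h5 : (n : ℝ) * (N.gcd (p ^ ν - 1) : ℝ) ≤ n * (κ * (p : ℝ) ^ ((ν : ℝ) / 2)) := by
    rw [h3]
    calc ((p ^ ν - 1 : ℕ) : ℝ) * (n.gcd M : ℝ)
        ≤ ((p : ℝ) ^ ((ν : ℝ) / 2) * (p : ℝ) ^ ((ν : ℝ) / 2)) *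
          (κ * (n / (p : ℝ) ^ ((ν : ℝ) / 2))) := by gcongr
      _ = _ := by field_simp
  refine (le_of_mul_le_mul_left h5 hn0').trans ?_
  gcongr
  rw [Nat.cast_pow, ← Real.rpow_natCast, ← Real.rpow_mul hp0.le]
  refine Real.rpow_le_rpow_of_exponent_le hp1 ?_
  obtain ⟨d, rfl⟩ := hν
  -- A proper divisor satisfies `ν ≤ m / 2`, which turns `p ^ (ν / 2)` into at most `q ^ (1/4)`.
  have hd : 2 ≤ d := by
    by_contra! hd
    interval_cases d <;> simp at hνm
  have hd' : (2 : ℝ) ≤ d := by exact_mod_cast hd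
  have hν' : (0 : ℝ) ≤ ν := Nat.cast_nonneg _
  push_cast
  nlinarith

/-! ### Reduction of the Gauss sum to a mean over the group of powers -/

section powers

variable {p : ℕ} [Fact p.Prime] {F : Type*} [Field F] [Fintype F] [Algebra (ZMod p) F]

/-- The additive character `x ↦ psi p (a x)`. -/
noncomputable def psiShift (p : ℕ) [Fact p.Prime] {F : Type*} [Field F] [Algebra (ZMod p) F]
    (a : F) : AddChar F ℂ :=
  ((ZMod.stdAddChar (N := p)).compAddMonoidHom
    (Algebra.trace (ZMod p) F).toAddMonoidHom).mulShift a

lemma psiShift_apply {p : ℕ} [Fact p.Prime] {F : Type*} [Field F] [Algebra (ZMod p) F] (a x : F) :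
    psiShift p a x = psi p (a * x) := rfl

lemma isPrimitive_psiShift {a : F} (ha : a ≠ 0) : (psiShift p a).IsPrimitive := by
  have h : ((ZMod.stdAddChar (N := p)).compAddMonoidHom
      (Algebra.trace (ZMod p) F).toAddMonoidHom) ≠ 1 := by
    intro h
    obtain ⟨x, hx⟩ := Algebra.trace_surjective (ZMod p) F 1
    have h1 := DFunLike.congr_fun h x
    have h2 : ZMod.stdAddChar (N := p) 1 = 1 := by rw [← hx]; exact h1
    have h3 := ZMod.injective_stdAddChar (N := p) (h2.trans (AddChar.map_zero_eq_one _).symm)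
    exact one_ne_zero h3
  exact AddChar.IsPrimitive.of_ne_one (AddChar.IsPrimitive.of_ne_one h ha)

/-- The inclusion of the group of `n`-th powers into the field. -/
def powerInclusion (F : Type*) [Field F] (n : ℕ) : (powMonoidHom n : Fˣ →* Fˣ).range →* F :=
  (Units.coeHom F).comp (Subgroup.subtype _)

lemma powerInclusion_injective {F : Type*} [Field F] (n : ℕ) :
    Function.Injective (powerInclusion F n) :=
  Units.val_injective.comp Subtype.val_injective

lemma card_powers {n : ℕ} [Fintype (powMonoidHom n : Fˣ →* Fˣ).range]
    (hn : n ∣ Fintype.card F - 1) :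
    Fintype.card (powMonoidHom n : Fˣ →* Fˣ).range = (Fintype.card F - 1) / n := by
  classical
  rw [← Nat.card_eq_fintype_card, IsCyclic.card_powMonoidHom_range, Nat.card_eq_fintype_card,
    Fintype.card_units, Nat.gcd_eq_right hn]

lemma powerGaussSum_eq {n : ℕ} [Fintype (powMonoidHom n : Fˣ →* Fˣ).range]
    (hn : n ∣ Fintype.card F - 1) (hn0 : 0 < n) (a : F) :
    powerGaussSum p n a =
      1 + (Fintype.card F - 1 : ℕ) * charMean (psiShift p a) (powerInclusion F n) 1 := by
  classical
  obtain ⟨N, hN⟩ := id hn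
  have hcard := card_powers hn
  rw [hN, Nat.mul_div_cancel_left _ hn0] at hcard
  have h0 : powerGaussSum p n a = 1 + ∑ x : Fˣ, psi p (a * (x : F) ^ n) := by
    rw [powerGaussSum, ← Finset.add_sum_erase _ _ (Finset.mem_univ (0 : F))]
    congr 1
    · rw [zero_pow hn0.ne', ← psiShift_apply, AddChar.map_zero_eq_one]
    · symm
      refine Finset.sum_bij (fun x _ => (x : F)) (fun x _ => by simp) (fun _ _ _ _ h => Units.ext h)
        (fun y hy => ⟨Units.mk0 y (Finset.ne_of_mem_erase hy), Finset.mem_univ _, rfl⟩)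
        fun _ _ => rfl
  -- All fibres of `x ↦ x ^ n` on `Fˣ` have equal size, and there are `N` of them.
  have hker : ∀ g : (powMonoidHom n : Fˣ →* Fˣ).range,
      (Finset.univ.filter fun x : Fˣ => (powMonoidHom n : Fˣ →* Fˣ).rangeRestrict x = g).card
        = n := by
    intro g
    have hs := (powMonoidHom n : Fˣ →* Fˣ).rangeRestrict_surjective
    have htot : ∑ h : (powMonoidHom n : Fˣ →* Fˣ).range, (Finset.univ.filter fun x : Fˣ =>
        (powMonoidHom n : Fˣ →* Fˣ).rangeRestrict x = h).card = n * N := by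
      rw [← Finset.card_eq_sum_card_fiberwise (fun _ _ => Finset.mem_univ _), Finset.card_univ,
        Fintype.card_units, hN]
    rw [Finset.sum_congr rfl fun h _ =>
      MonoidHom.card_fiber_eq_of_mem_range (powMonoidHom n : Fˣ →* Fˣ).rangeRestrict (hs h) (hs g),
      Finset.sum_const, Finset.card_univ,
      hcard, smul_eq_mul, mul_comm] at htot
    have hNpos : 0 < N := hcard ▸ Fintype.card_pos
    exact Nat.eq_of_mul_eq_mul_right hNpos htot
  have h1 : ∑ x : Fˣ, psi p (a * (x : F) ^ n) =
      n * ∑ g, psiShift p a (powerInclusion F n g * 1) := by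
    rw [← Finset.sum_fiberwise_of_maps_to (t := Finset.univ)
      (g := (powMonoidHom n : Fˣ →* Fˣ).rangeRestrict) fun _ _ => Finset.mem_univ _,
      Finset.mul_sum]
    refine Finset.sum_congr rfl fun g _ => ?_
    rw [Finset.sum_congr rfl fun x hx => ?_, Finset.sum_const, hker g, nsmul_eq_mul]
    rw [← (Finset.mem_filter.1 hx).2, mul_one, psiShift_apply]
    rfl
  rw [h0, h1, ← card_mul_charMean, hcard, hN]
  push_cast
  ring

/-- The elements of the group of `n`-th powers that are trivial or lie in a proper subfield. -/
lemma exists_finset_generating {κ : ℝ} {m n : ℕ} [Fintype (powMonoidHom n : Fˣ →* Fˣ).range]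
    (hF : Fintype.card F = p ^ m) (hκ : 0 ≤ κ) (hn : n ∣ p ^ m - 1) (hn0 : 0 < n)
    (h : SubfieldGcdBound κ p m n) :
    ∃ B : Finset (powMonoidHom n : Fˣ →* Fˣ).range,
      (∀ g ∉ B, g ≠ 1 ∧ Subring.closure {powerInclusion F n g} = ⊤) ∧
      (B.card : ℝ) ≤ 1 + m * (κ * ((p ^ m : ℕ) : ℝ) ^ (1 / 4 : ℝ)) := by
  classical
  let J : Finset ℕ := (Finset.range m).filter fun ν => 1 ≤ ν ∧ ν ∣ m
  let T : ℕ → Finset (powMonoidHom n : Fˣ →* Fˣ).range :=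
    fun ν => Finset.univ.filter fun g => g ^ (p ^ ν - 1) = 1
  refine ⟨insert 1 (J.biUnion T), fun g hg => ?_, ?_⟩
  · rw [Finset.mem_insert, not_or] at hg
    refine ⟨hg.1, subring_closure_eq_top_of_pow_ne hF fun ν hν1 hνm hν heq => hg.2 ?_⟩
    refine Finset.mem_biUnion.2 ⟨ν, by simp [J, hν1, hνm, hν], ?_⟩
    simp only [T, Finset.mem_filter, Finset.mem_univ, true_and]
    have hpos : 0 < p ^ ν := pow_pos (Fact.out : p.Prime).pos _
    rw [← map_pow] at heq
    have h1 := powerInclusion_injective n heq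
    rw [← Nat.sub_add_cancel hpos, pow_succ] at h1
    exact mul_eq_right.1 h1
  · have h1 : (insert 1 (J.biUnion T)).card ≤ 1 + ∑ ν ∈ J, (T ν).card := by
      refine (Finset.card_insert_le _ _).trans ?_
      rw [add_comm]
      gcongr
      exact Finset.card_biUnion_le
    have h2 : ((1 + ∑ ν ∈ J, (T ν).card : ℕ) : ℝ) ≤
        1 + J.card * (κ * ((p ^ m : ℕ) : ℝ) ^ (1 / 4 : ℝ)) := by
      rw [Nat.cast_add, Nat.cast_one, Nat.cast_sum, ← nsmul_eq_mul]
      gcongr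
      refine Finset.sum_le_card_nsmul _ _ _ fun ν hν => ?_
      simp only [J, Finset.mem_filter, Finset.mem_range] at hν
      have h3 := gcd_div_le_of_subfieldGcdBound hκ hn hn0 h hν.2.1 hν.1 hν.2.2
      rw [← hF, ← card_powers (hF.symm ▸ hn), hF] at h3
      refine le_trans ?_ h3
      exact Nat.cast_le.2 (card_pow_eq_one_le_gcd (p ^ ν - 1))
    refine (Nat.cast_le.2 h1).trans (h2.trans ?_)
    gcongr
    exact (Finset.card_filter_le _ _).trans (Finset.card_range m).le

end powers

/-! ### The bounds for Gauss sums -/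

section bounds

variable {p : ℕ} [Fact p.Prime] {F : Type*} [Field F] [Fintype F] [Algebra (ZMod p) F]

/-- The classical bound for `S_n(a)`. -/
lemma norm_powerGaussSum_le_sqrt {n : ℕ} (hn : n ∣ Fintype.card F - 1) (hn0 : 0 < n) {a : F}
    (ha : a ≠ 0) :
    ‖powerGaussSum p n a‖ ≤ 2 * ((Fintype.card F : ℝ) ^ (1 / 2 : ℝ) * n) := by
  classical
  rw [powerGaussSum_eq hn hn0]
  have hPar := card_mul_norm_charMean_sq_le (psiShift p a) (powerInclusion F n)
    (isPrimitive_psiShift ha) (powerInclusion_injective n)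
  have hN : (0 : ℝ) < Fintype.card (powMonoidHom n : Fˣ →* Fˣ).range := by
    exact_mod_cast Fintype.card_pos
  have hcard := card_powers hn
  have hq1 : (Fintype.card F - 1 : ℕ) = n * Fintype.card (powMonoidHom n : Fˣ →* Fˣ).range := by
    rw [hcard, Nat.mul_div_cancel' hn]
  rw [hq1]
  set N : ℝ := (Fintype.card (powMonoidHom n : Fˣ →* Fˣ).range : ℝ) with hN_def
  set μ := charMean (psiShift p a) (powerInclusion F n) 1
  have hq : (1 : ℝ) ≤ Fintype.card F := by exact_mod_cast Fintype.card_pos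
  have hn1 : (1 : ℝ) ≤ n := by exact_mod_cast hn0
  rw [← Real.sqrt_eq_rpow]
  have hNμ : N * ‖μ‖ ≤ √(Fintype.card F) := by
    refine Real.le_sqrt_of_sq_le ?_
    rw [le_div_iff₀ hN] at hPar
    linarith [(by ring : (N * ‖μ‖) ^ 2 = N * ‖μ‖ ^ 2 * N)]
  have hs : (1 : ℝ) ≤ √(Fintype.card F) := Real.one_le_sqrt.2 hq
  refine (norm_add_le _ _).trans ?_
  rw [norm_one, norm_mul, Complex.norm_natCast, Nat.cast_mul]
  change 1 + (n : ℝ) * N * ‖μ‖ ≤ _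
  have h1 : (n : ℝ) * (N * ‖μ‖) ≤ n * √(Fintype.card F) := by gcongr
  nlinarith

lemma natCast_le_rpow_of_pow {p m : ℕ} (hp : 2 ≤ p) :
    (m : ℝ) ≤ 200 * ((p ^ m : ℕ) : ℝ) ^ (1 / 100 : ℝ) := by
  have hp0 : (0 : ℝ) < p := by exact_mod_cast (by omega : 0 < p)
  have h1 := Real.log_le_rpow_div (x := ((p ^ m : ℕ) : ℝ)) (ε := 1 / 100) (Nat.cast_nonneg _)
    (by norm_num)
  have h2 : (1 / 2 : ℝ) ≤ Real.log p := by
    have : Real.log 2 ≤ Real.log p := Real.log_le_log two_pos (by exact_mod_cast hp)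
    linarith [Real.log_two_gt_d9]
  have h3 : Real.log ((p ^ m : ℕ) : ℝ) = m * Real.log p := by
    rw [Nat.cast_pow, Real.log_pow]
  rw [h3] at h1
  have h4 : (m : ℝ) * (1 / 2) ≤ m * Real.log p := by gcongr
  linarith

/-- The alternatives are whether the exceptional set `B` is small enough for the main bound. If not,
`N * μ ^ 14 < 2 * |B|` is itself a bound for `μ`. -/
lemma norm_powerGaussSum_le_max {κ E : ℝ} (hκ : 0 ≤ κ) (hE : 1 ≤ E) {m n : ℕ}
    (hF : Fintype.card F = p ^ m) (hn : n ∣ p ^ m - 1) (hn0 : 0 < n)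
    (hsub : SubfieldGcdBound κ p m n) {a : F} (ha : a ≠ 0)
    (hnE : (n : ℝ) ≤ E * ((p ^ m : ℕ) : ℝ) ^ (52 / 100 : ℝ)) :
    ‖powerGaussSum p n a‖ ≤
        3 * (((p ^ m : ℕ) : ℝ) ^ (54 / 56 : ℝ) * (n : ℝ) ^ (3 / 56 : ℝ)) ∨
      ‖powerGaussSum p n a‖ ≤
        (1 + 4 * (1 + 200 * κ) * E) * ((p ^ m : ℕ) : ℝ) ^ (985 / 1000 : ℝ) := by
  classical
  have hn' : n ∣ Fintype.card F - 1 := hF ▸ hn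
  have hS := powerGaussSum_eq (p := p) hn' hn0 a
  obtain ⟨B, hB, hBcard⟩ := exists_finset_generating hF hκ hn hn0 hsub
  have hmain := card_pow_three_mul_norm_charMean_le (psiShift p a) (powerInclusion F n)
    (isPrimitive_psiShift ha) (powerInclusion_injective n) B hB
  have hq2 : 2 ≤ p ^ m := hF ▸ Fintype.one_lt_card (α := F)
  have hm := natCast_le_rpow_of_pow (p := p) (m := m) (Fact.out : p.Prime).two_le
  have hNn : ((p ^ m : ℕ) : ℝ) ≤ 2 * (n * Fintype.card (powMonoidHom n : Fˣ →* Fˣ).range) := by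
    rw [card_powers hn', hF, ← Nat.cast_mul, Nat.mul_div_cancel' hn]
    exact_mod_cast (by omega : p ^ m ≤ 2 * (p ^ m - 1))
  have hSle : ‖powerGaussSum p n a‖ ≤
      1 + (p ^ m : ℕ) * ‖charMean (psiShift p a) (powerInclusion F n) 1‖ := by
    rw [hS]
    refine (norm_add_le _ _).trans ?_
    rw [norm_one, norm_mul, Complex.norm_natCast, hF]
    gcongr
    exact Nat.sub_le _ _
  rw [hF] at hmain
  have hN : (0 : ℝ) < Fintype.card (powMonoidHom n : Fˣ →* Fˣ).range := by
    exact_mod_cast Fintype.card_pos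
  have hμ0 := norm_nonneg (charMean (psiShift p a) (powerInclusion F n) 1)
  have hq : (2 : ℝ) ≤ ((p ^ m : ℕ) : ℝ) := by exact_mod_cast hq2
  have hn1 : (1 : ℝ) ≤ n := by exact_mod_cast hn0
  generalize ‖charMean (psiShift p a) (powerInclusion F n) 1‖ = μ at *
  generalize (Fintype.card (powMonoidHom n : Fˣ →* Fˣ).range : ℝ) = N at *
  generalize ((p ^ m : ℕ) : ℝ) = q at *
  have hq0 : 0 < q := by linarith
  have hq1 : 1 ≤ q := by linarith
  by_cases hcase : 2 * (B.card : ℝ) ≤ N * μ ^ 14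
  · left
    have h1 := hmain hcase
    have h2 : μ ^ 56 * q ^ 2 ≤ 2 ^ 17 * n ^ 3 := by
      have h3 : q ^ 3 * μ ^ 56 ≤ (2 * (n * N)) ^ 3 * μ ^ 56 := by gcongr
      have h4 : (2 * (n * N)) ^ 3 * μ ^ 56 ≤ 8 * n ^ 3 * (2 ^ 14 * q) := by
        calc (2 * (n * N)) ^ 3 * μ ^ 56 = 8 * n ^ 3 * (N ^ 3 * μ ^ 56) := by ring
          _ ≤ _ := by gcongr
      refine le_of_mul_le_mul_right ?_ hq0
      linarith
    have h3 : q * μ ≤ 2 * (q ^ (54 / 56 : ℝ) * (n : ℝ) ^ (3 / 56 : ℝ)) := by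
      refine le_of_pow_le_pow_left₀ (n := 56) (by norm_num) (by positivity) ?_
      have hr1 : (q ^ (54 / 56 : ℝ)) ^ 56 = q ^ 54 := by
        rw [← Real.rpow_natCast, ← Real.rpow_mul hq0.le, ← Real.rpow_natCast]
        norm_num
      have hr2 : ((n : ℝ) ^ (3 / 56 : ℝ)) ^ 56 = (n : ℝ) ^ 3 := by
        rw [← Real.rpow_natCast, ← Real.rpow_mul (Nat.cast_nonneg _), ← Real.rpow_natCast]
        norm_num
      rw [mul_pow, mul_pow, mul_pow, hr1, hr2]
      calc q ^ 56 * μ ^ 56 = q ^ 54 * (μ ^ 56 * q ^ 2) := by ring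
        _ ≤ q ^ 54 * (2 ^ 17 * n ^ 3) := by gcongr
        _ ≤ q ^ 54 * (2 ^ 56 * n ^ 3) := by gcongr <;> norm_num
        _ = _ := by ring
    have h4 : 1 ≤ q ^ (54 / 56 : ℝ) * (n : ℝ) ^ (3 / 56 : ℝ) :=
      one_le_mul_of_one_le_of_one_le (Real.one_le_rpow hq1 (by norm_num))
        (Real.one_le_rpow hn1 (by norm_num))
    linarith
  · right
    push Not at hcase
    set K := 4 * (1 + 200 * κ) * E with hK
    have hK1 : 1 ≤ K := by
      rw [hK]
      nlinarith [mul_nonneg hκ (by linarith : (0 : ℝ) ≤ E)]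
    have hB' : (B.card : ℝ) ≤ (1 + 200 * κ) * q ^ (26 / 100 : ℝ) := by
      have h1 : (m : ℝ) * (κ * q ^ (1 / 4 : ℝ)) ≤ 200 * κ * q ^ (26 / 100 : ℝ) := by
        calc (m : ℝ) * (κ * q ^ (1 / 4 : ℝ))
            ≤ 200 * q ^ (1 / 100 : ℝ) * (κ * q ^ (1 / 4 : ℝ)) := by gcongr
          _ = 200 * κ * (q ^ (1 / 100 : ℝ) * q ^ (1 / 4 : ℝ)) := by ring
          _ = _ := by rw [← Real.rpow_add hq0]; norm_num
      have h2 : 1 ≤ q ^ (26 / 100 : ℝ) := Real.one_le_rpow hq1 (by norm_num)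
      linarith
    -- Here `0.78 = 0.52 + 0.26`, where `0.26` is `1/4` from the gcd bound plus `1/100` for the
    -- number of subfields. The 14th root gives `1 - 0.22 / 14 < 0.985`.
    have h1 : q * μ ^ 14 ≤ K * q ^ (78 / 100 : ℝ) := by
      calc q * μ ^ 14 ≤ 2 * (n * N) * μ ^ 14 := by gcongr
        _ = 2 * n * (N * μ ^ 14) := by ring
        _ ≤ 2 * (E * q ^ (52 / 100 : ℝ)) * (2 * ((1 + 200 * κ) * q ^ (26 / 100 : ℝ))) := by
          exact mul_le_mul (by linarith) (by linarith) (by positivity) (by positivity)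
        _ = K * (q ^ (52 / 100 : ℝ) * q ^ (26 / 100 : ℝ)) := by rw [hK]; ring
        _ = _ := by rw [← Real.rpow_add hq0]; norm_num
    have h2 : q * μ ≤ K * q ^ (985 / 1000 : ℝ) := by
      refine le_of_pow_le_pow_left₀ (n := 14) (by norm_num) (by positivity) ?_
      have hr1 : (q ^ (985 / 1000 : ℝ)) ^ 14 = q ^ (1379 / 100 : ℝ) := by
        rw [← Real.rpow_natCast, ← Real.rpow_mul hq0.le]
        norm_num
      have hr2 : q ^ 13 * q ^ (78 / 100 : ℝ) = q ^ (1378 / 100 : ℝ) := by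
        rw [← Real.rpow_natCast, ← Real.rpow_add hq0]
        norm_num
      rw [mul_pow, mul_pow, hr1]
      calc q ^ 14 * μ ^ 14 = q ^ 13 * (q * μ ^ 14) := by ring
        _ ≤ q ^ 13 * (K * q ^ (78 / 100 : ℝ)) := by gcongr
        _ = K * q ^ (1378 / 100 : ℝ) := by rw [← hr2]; ring
        _ ≤ K ^ 14 * q ^ (1379 / 100 : ℝ) := by
          gcongr
          · exact le_self_pow₀ hK1 (by norm_num)
          · norm_num
    have h3 : 1 ≤ q ^ (985 / 1000 : ℝ) := Real.one_le_rpow hq1 (by norm_num)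
    linarith

end bounds

/-! ### Comparison of exponents and removal of logarithms -/

lemma rpow_mul_rpow_le {q x E α β γ η : ℝ} (hq : 1 ≤ q) (hx : 1 ≤ x) (hE : 0 ≤ E)
    (h : q ^ (491 / 1000 : ℝ) ≤ E * x) (hηγ : η ≤ γ)
    (hβ : β ≤ α + 491 / 1000 * (γ - η)) :
    q ^ β * x ^ η ≤ E ^ (γ - η) * (q ^ α * x ^ γ) := by
  have hq0 : 0 < q := by linarith
  have hx0 : 0 < x := by linarith
  calc q ^ β * x ^ η ≤ q ^ (α + 491 / 1000 * (γ - η)) * x ^ η := by gcongr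
    _ = q ^ α * (q ^ (491 / 1000 : ℝ)) ^ (γ - η) * x ^ η := by
      rw [Real.rpow_add hq0, Real.rpow_mul hq0.le]
    _ ≤ q ^ α * (E * x) ^ (γ - η) * x ^ η := by
      have := sub_nonneg.2 hηγ
      gcongr
    _ = E ^ (γ - η) * (q ^ α * (x ^ (γ - η) * x ^ η)) := by
      rw [Real.mul_rpow hE hx0.le]
      ring
    _ = _ := by rw [← Real.rpow_add hx0, sub_add_cancel]

/-- Since `γ ≥ 3/56`, the comparison is tightest at the smallest `n`, about `q ^ 0.491`, where it
becomes the numerical condition on `α, γ`. -/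
lemma exists_norm_powerGaussSum_le {κ E : ℝ} (hκ : 0 < κ) (hE : 1 ≤ E) {α γ : ℝ}
    (hγ : 3 / 56 ≤ γ) (h1 : 54 / 56 ≤ α + 491 / 1000 * (γ - 3 / 56)) :
    ∃ C : ℝ, 0 < C ∧ ∀ (p m n : ℕ) [Fact p.Prime] (F : Type*) [Field F] [Fintype F]
      [Algebra (ZMod p) F], Fintype.card F = p ^ m → n ∣ p ^ m - 1 → SubfieldGcdBound κ p m n →
      ((p ^ m : ℕ) : ℝ) ^ (491 / 1000 : ℝ) ≤ E * n →
      (n : ℝ) ≤ E * ((p ^ m : ℕ) : ℝ) ^ (52 / 100 : ℝ) →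
      ∀ a : F, a ≠ 0 →
        ‖powerGaussSum p n a‖ ≤ C * (((p ^ m : ℕ) : ℝ) ^ α * (n : ℝ) ^ γ) := by
  refine ⟨3 * E ^ (γ - 3 / 56) + (1 + 4 * (1 + 200 * κ) * E) * E ^ (γ - 0), by positivity, ?_⟩
  intro p m n _ F _ _ _ hF hn hsub hlow hup a ha
  have hq2 : 2 ≤ p ^ m := hF ▸ Fintype.one_lt_card (α := F)
  have hn0 : 0 < n := Nat.pos_of_ne_zero fun h => by
    rw [h, zero_dvd_iff] at hn
    omega
  have hq : (1 : ℝ) ≤ ((p ^ m : ℕ) : ℝ) := by exact_mod_cast (by omega : 1 ≤ p ^ m)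
  have hn1 : (1 : ℝ) ≤ n := by exact_mod_cast hn0
  have hE0 : (0 : ℝ) ≤ E := by linarith
  rw [add_mul]
  rcases norm_powerGaussSum_le_max hκ.le hE hF hn hn0 hsub ha hup with h | h
  · refine h.trans (le_add_of_le_of_nonneg ?_ (by positivity))
    rw [mul_assoc]
    gcongr 3 * ?_
    exact rpow_mul_rpow_le hq hn1 hE0 hlow hγ h1
  · refine h.trans (le_add_of_nonneg_of_le (by positivity) ?_)
    rw [mul_assoc _ (E ^ (γ - 0))]
    refine mul_le_mul_of_nonneg_left ?_ (by positivity)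
    have := rpow_mul_rpow_le (α := α) (β := 985 / 1000) (γ := γ) (η := 0) hq hn1 hE0 hlow
      (by linarith) (by linarith)
    rwa [Real.rpow_zero, mul_one] at this

lemma log_rpow_le {c q x : ℝ} (hc : 0 < c) (hq : 1 ≤ q) (hx : 1 ≤ x) (hxq : x ≤ q) :
    Real.log x ^ c ≤ (1000 * c) ^ c * q ^ (1 / 1000 : ℝ) := by
  have hq0 : 0 < q := by linarith
  have h1 : Real.log x ≤ 1000 * c * q ^ (1 / 1000 / c : ℝ) := by
    refine (Real.log_le_log (by linarith) hxq).trans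
      ((Real.log_le_rpow_div hq0.le (by positivity : 0 < 1 / 1000 / c)).trans (le_of_eq ?_))
    field_simp
  calc Real.log x ^ c ≤ (1000 * c * q ^ (1 / 1000 / c : ℝ)) ^ c := by
        gcongr
        exact Real.log_nonneg hx
    _ = _ := by
      rw [Real.mul_rpow (by positivity) (by positivity), ← Real.rpow_mul hq0.le,
        div_mul_cancel₀ _ hc.ne']

lemma le_of_leUpToLog {k c q x y : ℝ} (hk : 0 < k) (hc : 0 < c) (hq : 1 ≤ q) (hy : 1 ≤ y)
    (hyq : y ≤ q) (h : LeUpToLog k c x y) : x ≤ k * (1000 * c) ^ c * (q ^ (1 / 1000 : ℝ) * y) := by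
  unfold LeUpToLog at h
  calc x ≤ k * Real.log y ^ c * y := h
    _ ≤ k * ((1000 * c) ^ c * q ^ (1 / 1000 : ℝ)) * y := by
      gcongr
      exact log_rpow_le hc hq hy hyq
    _ = _ := by ring

/-- The logarithm costs `q ^ (1/1000)`, hence the drop from `492/1000` to `491/1000`; note `1/2 -
1/130 > 492/1000`. -/
lemma rpow_le_of_leUpToLog {k c q x θ : ℝ} (hk : 0 < k) (hc : 0 < c) (hq : 1 ≤ q) (hx : 1 ≤ x)
    (hxq : x ≤ q) (hθ : 492 / 1000 ≤ θ) (h : LeUpToLog k c (q ^ θ) x) :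
    q ^ (491 / 1000 : ℝ) ≤ k * (1000 * c) ^ c * x := by
  have hq0 : 0 < q := by linarith
  have h1 := le_of_leUpToLog hk hc hq hx hxq h
  refine le_of_mul_le_mul_left ?_ (Real.rpow_pos_of_pos hq0 (1 / 1000))
  calc q ^ (1 / 1000 : ℝ) * q ^ (491 / 1000 : ℝ) = q ^ (492 / 1000 : ℝ) := by
        rw [← Real.rpow_add hq0]; norm_num
    _ ≤ q ^ θ := Real.rpow_le_rpow_of_exponent_le hq hθ
    _ ≤ _ := h1
    _ = _ := by ring

theorem corollary7 :
    ∃ o : ℕ → ℝ, Tendsto o atTop (𝓝 0) ∧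
    ∀ κ k c : ℝ, 0 < κ → 0 < k → 0 < c → ∃ C : ℝ, 0 < C ∧
    ∀ (p m q n : ℕ) [Fact p.Prime] (F : Type*) [Field F] [Fintype F] [Algebra (ZMod p) F],
      q = p ^ m → Fintype.card F = q → n ∣ q - 1 → SubfieldGcdBound κ p m n →
      ∀ a : F, a ≠ 0 →
        (LeUpToLog k c n ((q : ℝ) ^ (1 / 2 - 1 / 130 : ℝ)) →
          ‖powerGaussSum p n a‖ ≤ C * ((q : ℝ) ^ (1 / 2 : ℝ) * n)) ∧
        (LeUpToLog k c ((q : ℝ) ^ (1 / 2 - 1 / 130 : ℝ)) n →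
          (n : ℝ) ≤ k * (q : ℝ) ^ (1 / 2 : ℝ) →
          ‖powerGaussSum p n a‖ ≤
            C * ((q : ℝ) ^ (92 / 128 + o q : ℝ) * (n : ℝ) ^ (71 / 128 : ℝ))) ∧
        ((q : ℝ) ^ (1 / 2 : ℝ) ≤ k * n →
          LeUpToLog k c n ((q : ℝ) ^ (1 / 2 + 1 / 2642 : ℝ)) →
          ‖powerGaussSum p n a‖ ≤
            C * ((q : ℝ) ^ (91 / 128 + o q : ℝ) * (n : ℝ) ^ (73 / 128 : ℝ))) ∧
        (∀ ε : ℝ, 0 < ε →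
          LeUpToLog k c ((q : ℝ) ^ (1 / 2 + 1 / 2642 : ℝ)) n →
          (n : ℝ) ≤ k * (q : ℝ) ^ (1 / 2 + 1 / 68 - ε : ℝ) →
          ‖powerGaussSum p n a‖ ≤
            C * ((q : ℝ) ^ (229 / 264 : ℝ) * (n : ℝ) ^ (17 / 66 : ℝ))) := by
  -- The saving of a power of `q` allows `o` to vanish identically.
  refine ⟨fun _ => 0, tendsto_const_nhds, fun κ k c hκ hk hc => ?_⟩
  set E : ℝ := 1 + k + k * (1000 * c) ^ c with hE_def
  have hkc : 0 < k * (1000 * c) ^ c := by positivity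
  have hE : 1 ≤ E := by linarith
  have hkE : k ≤ E := by linarith
  have hkcE : k * (1000 * c) ^ c ≤ E := by linarith
  obtain ⟨C₁, hC₁, H₁⟩ := exists_norm_powerGaussSum_le hκ hE (α := 92 / 128) (γ := 71 / 128)
    (by norm_num) (by norm_num)
  obtain ⟨C₂, hC₂, H₂⟩ := exists_norm_powerGaussSum_le hκ hE (α := 91 / 128) (γ := 73 / 128)
    (by norm_num) (by norm_num)
  obtain ⟨C₃, hC₃, H₃⟩ := exists_norm_powerGaussSum_le hκ hE (α := 229 / 264) (γ := 17 / 66)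
    (by norm_num) (by norm_num)
  refine ⟨2 + C₁ + C₂ + C₃, by positivity, ?_⟩
  intro p m q n _ F _ _ _ hq hF hn hsub a ha
  subst hq
  have hq2 : 2 ≤ p ^ m := hF ▸ Fintype.one_lt_card (α := F)
  have hn0 : 0 < n := Nat.pos_of_ne_zero fun h => by
    rw [h, zero_dvd_iff] at hn
    omega
  have hq : (1 : ℝ) ≤ ((p ^ m : ℕ) : ℝ) := by exact_mod_cast (by omega : 1 ≤ p ^ m)
  have hq0 : (0 : ℝ) < ((p ^ m : ℕ) : ℝ) := by linarith
  have hn1 : (1 : ℝ) ≤ n := by exact_mod_cast hn0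
  have hnq : (n : ℝ) ≤ ((p ^ m : ℕ) : ℝ) := by
    exact_mod_cast (Nat.le_of_dvd (by omega) hn).trans (Nat.sub_le _ _)
  have hup : ∀ {D θ : ℝ}, 0 ≤ D → D ≤ E → θ ≤ 52 / 100 → (n : ℝ) ≤ D * ((p ^ m : ℕ) : ℝ) ^ θ →
      (n : ℝ) ≤ E * ((p ^ m : ℕ) : ℝ) ^ (52 / 100 : ℝ) := fun hD0 hD hθ h =>
    h.trans (mul_le_mul hD (Real.rpow_le_rpow_of_exponent_le hq hθ) (by positivity)
      (by linarith))
  have hlow : ∀ {θ : ℝ}, 492 / 1000 ≤ θ → LeUpToLog k c (((p ^ m : ℕ) : ℝ) ^ θ) n →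
      ((p ^ m : ℕ) : ℝ) ^ (491 / 1000 : ℝ) ≤ E * n := fun hθ h =>
    (rpow_le_of_leUpToLog hk hc hq hn1 hnq hθ h).trans (by gcongr)
  have hC : ∀ {D X : ℝ}, D ≤ 2 + C₁ + C₂ + C₃ → 0 ≤ X → ‖powerGaussSum p n a‖ ≤ D * X →
      ‖powerGaussSum p n a‖ ≤ (2 + C₁ + C₂ + C₃) * X := fun hD hX h =>
    h.trans (mul_le_mul_of_nonneg_right hD hX)
  simp only [add_zero]
  refine ⟨fun _ => ?_, fun h1 h2 => ?_, fun h1 h2 => ?_, fun ε hε h1 h2 => ?_⟩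
  · refine hC (by linarith : (2 : ℝ) ≤ _) (by positivity) ?_
    rw [← hF]
    exact norm_powerGaussSum_le_sqrt (hF ▸ hn) hn0 ha
  · exact hC (by linarith) (by positivity)
      (H₁ p m n F hF hn hsub (hlow (by norm_num) h1) (hup hk.le hkE (by norm_num) h2) a ha)
  · refine hC (by linarith) (by positivity) (H₂ p m n F hF hn hsub ?_ ?_ a ha)
    · calc ((p ^ m : ℕ) : ℝ) ^ (491 / 1000 : ℝ) ≤ ((p ^ m : ℕ) : ℝ) ^ (1 / 2 : ℝ) :=
            Real.rpow_le_rpow_of_exponent_le hq (by norm_num)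
        _ ≤ k * n := h1
        _ ≤ E * n := by gcongr
    · have h3 := le_of_leUpToLog hk hc hq (Real.one_le_rpow hq (by norm_num))
        (Real.rpow_le_self_of_one_le hq (by norm_num)) h2
      rw [← Real.rpow_add hq0] at h3
      exact hup hkc.le hkcE (by norm_num) h3
  · exact hC (by linarith) (by positivity)
      (H₃ p m n F hF hn hsub (hlow (by norm_num) h1) (hup hk.le hkE (by linarith) h2) a ha)
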